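/- Let $S\in\{\tfrac12,1,\tfrac32,\dots\}$, let $\ell\ge 1$ be an integer, and let $\Lambda_\ell=\{1,\dots,\ell\}^3\subset\mathbb Z^3$ be the cubic box with $\ell$ sites per side. On $\mathcal H=\bigotimes_{\mathbf x\in\Lambda_\ell}\mathbb C^{2S+1}$ let $\mathbf S_{\mathbf x}=(S^1_{\mathbf x},S^2_{\mathbf x},S^3_{\mathbf x})$ denote the spin-$S$ operators at the site $\mathbf x$, and consider the Heisenberg Hamiltonian with free (Neumann) boundary conditions $$H_\ell=\sum_{\langle \mathbf x,\mathbf y\rangle\subset\Lambda_\ell}\left(S^2-\mathbf S_{\mathbf x}\cdot\mathbf S_{\mathbf y}\right),$$ where the sum runs over the unordered pairs of nearest neighbours in $\Lambda_\ell$. Let $\mathbf S_T=\sum_{\mathbf x\in\Lambda_\ell}\mathbf S_{\mathbf x}$ be the total spin and, for $S_T\ge 0$, let $\mathcal H_{S_T}=\{\psi\in\mathcal H:\ \mathbf S_T^2\psi=S_T(S_T+1)\psi\}$. Then $H_\ell$ is a symmetric operator that leaves every $\mathcal H_{S_T}$ invariant, and there is a universal constant $C>0$, independent of $S$, $\ell$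 and $S_T$, such that, in the sense of operators (quadratic forms), $$H_\ell\big|_{\mathcal H_{S_T}}\ \ge\ \frac{CS}{\ell^2}\left(S\ell^3-S_T\right).$$ In particular, the energy gap above the ground state energy is of order $S/\ell^2$: the lowest eigenvalue of $H_\ell$ is $0$, and there is a universal constant $C'$ such that for all $\ell\ge 2$ the smallest positive eigenvalue $g$ of $H_\ell$ exists and satisfies $CS\,\ell^{-2}\le g\le C'S\,\ell^{-2}$. -/

import Mathlib

noncomputable section

namespace Heisenberg

/-- The cubic box with `ℓ` lattice sites per side. -/
abbrev Box (ℓ : ℕ) : Type := Fin 3 → Fin ℓ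

/-- Two sites of the box are nearest neighbours when their `ℓ¹` distance in `ℤ³` is one.
No pairs are added across the boundary (free, i.e. Neumann, boundary conditions). -/
def Adj {ℓ : ℕ} (x y : Box ℓ) : Prop :=
  ∑ i : Fin 3, |((x i : ℕ) : ℤ) - ((y i : ℕ) : ℤ)| = 1

instance {ℓ : ℕ} (x y : Box ℓ) : Decidable (Adj x y) :=
  inferInstanceAs (Decidable (_ = _))

/-- The value `S = d / 2` of the spin, where `d = 2S` is a natural number. -/
def spin (d : ℕ) : ℝ := (d : ℝ) / 2

/-- The one-site raising operator on `ℂ^(2S+1)`, `d = 2S`. The basis vector with index `i`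
is the state with third component `m = i - S`, and
`S⁺|m⟩ = √(S(S+1) - m(m+1)) |m+1⟩`, which reads `√((d - j)(j + 1))` for `m = j - S`. -/
def spinRaise (d : ℕ) : Matrix (Fin (d + 1)) (Fin (d + 1)) ℂ :=
  Matrix.of fun i j =>
    if (i : ℕ) = (j : ℕ) + 1 then
      ((Real.sqrt (((d : ℝ) - (j : ℕ)) * ((j : ℕ) + 1)) : ℝ) : ℂ)
    else 0

/-- The three one-site spin operators `S¹, S², S³` on `ℂ^(2S+1)`, `d = 2S`, where
`S⁺ = S¹ + i S²` and `S⁻ = (S⁺)ᴴ = S¹ - i S²`. -/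
def spinMatrix (d : ℕ) : Fin 3 → Matrix (Fin (d + 1)) (Fin (d + 1)) ℂ :=
  ![(1 / 2 : ℂ) • (spinRaise d + (spinRaise d).conjTranspose),
    (1 / (2 * Complex.I) : ℂ) • (spinRaise d - (spinRaise d).conjTranspose),
    Matrix.diagonal fun i => (((i : ℕ) : ℝ) - spin d : ℝ)]

/-- The labels of the product basis of the Hilbert space of the box. -/
abbrev Config (d ℓ : ℕ) : Type := Box ℓ → Fin (d + 1)

/-- The Hilbert space `⨂_{x ∈ Λ_ℓ} ℂ^(2S+1)` in its product basis. -/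
abbrev Space (d ℓ : ℕ) : Type := EuclideanSpace ℂ (Config d ℓ)

/-- The one-site matrix `A` acting on the tensor factor at the site `x`. -/
def atSite {d ℓ : ℕ} (x : Box ℓ) (A : Matrix (Fin (d + 1)) (Fin (d + 1)) ℂ) :
    Matrix (Config d ℓ) (Config d ℓ) ℂ :=
  Matrix.of fun σ τ => if ∀ y, y ≠ x → σ y = τ y then A (σ x) (τ x) else 0

/-- `S_x · S_y`. -/
def spinDot (d : ℕ) {ℓ : ℕ} (x y : Box ℓ) : Matrix (Config d ℓ) (Config d ℓ) ℂ :=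
  ∑ a : Fin 3, atSite x (spinMatrix d a) * atSite y (spinMatrix d a)

/-- The Heisenberg Hamiltonian `∑ (S² - S_x · S_y)` over unordered nearest neighbour pairs;
the factor `1/2` is there because the sum below counts every such pair twice. -/
def hamiltonianMatrix (d ℓ : ℕ) : Matrix (Config d ℓ) (Config d ℓ) ℂ :=
  (1 / 2 : ℂ) • ∑ x : Box ℓ, ∑ y : Box ℓ,
    if Adj x y then ((spin d ^ 2 : ℝ) : ℂ) • (1 : Matrix (Config d ℓ) (Config d ℓ) ℂ)
      - spinDot d x y else 0

/-- The square of the total spin, `(∑_x S_x)² = ∑_a (∑_x S_x^a)²`. -/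
def totalSpinSqMatrix (d ℓ : ℕ) : Matrix (Config d ℓ) (Config d ℓ) ℂ :=
  ∑ a : Fin 3, (∑ x : Box ℓ, atSite x (spinMatrix d a)) ^ 2

/-- The Heisenberg Hamiltonian `H_ℓ` as an operator. -/
def hamiltonian (d ℓ : ℕ) : Space d ℓ →ₗ[ℂ] Space d ℓ :=
  Matrix.toEuclideanLin (hamiltonianMatrix d ℓ)

/-- The square of the total spin as an operator. -/
def totalSpinSq (d ℓ : ℕ) : Space d ℓ →ₗ[ℂ] Space d ℓ :=
  Matrix.toEuclideanLin (totalSpinSqMatrix d ℓ)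

/-- The subspace of total spin `s`, on which the square of the total spin is `s(s+1)`. -/
def sector (d ℓ : ℕ) (s : ℝ) : Submodule ℂ (Space d ℓ) :=
  Module.End.eigenspace (totalSpinSq d ℓ) ((s * (s + 1) : ℝ) : ℂ)

/-- The real numbers that are eigenvalues of `H_ℓ`. -/
def energies (d ℓ : ℕ) : Set ℝ :=
  {E : ℝ | Module.End.HasEigenvalue (hamiltonian d ℓ) (E : ℂ)}

end Heisenberg

end

/-! Replace each spin by `d` bosons of two kinds, a and b. For distinct sites x, y the interaction
S² - S_x·S_y is then half of A*A, where A = A_xy = a_x b_y - b_x a_y annihilates a singlet. Hence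
the energy is a sum of pair energies ‖A_xy Ψ‖² over neighbours.

The crux is that ‖A_xy Ψ‖ obeys the triangle inequality in the sites (`pairEnergy_triangle`). For
distinct sites, c_y A_xz = c_z A_xy + c_x A_yz for c = a and for c = b. Since A_xz leaves all `d`
bosons at y, summing ‖c_y A_xz Ψ‖² over both kinds gives d ‖A_xz Ψ‖², and likewise for the other two
terms.

A squared pseudometric satisfies a Poincaré inequality on the box (`IsSqDist.sum_le`): its sum over
all pairs is at most 9ℓ⁵ times its sum over neighbours. The total spin fixes the sum over all pairs
(`sum_pairEnergy`): with T = Sℓ³ it is 2(T - s)(T + s + 1)‖Ψ‖², which for 0 ≤ s ≤ T is at least 2(T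
- s)T‖Ψ‖². Dividing by ℓ⁵ leaves S(T - s)/ℓ², with constant 1/18 (`sector_bound`).

For the lower bound on the gap, SU(2) invariance turns an eigenvector into a highest weight vector
of the same energy. It lies in one sector, and T - s is an integer, at least 1 unless the energy is
zero. For the upper bound, a one-magnon state with amplitudes linear in one coordinate is orthogonal
to the kernel and has energy of order S/ℓ². -/

namespace Heisenberg

open Matrix Function

/-! ### Operators on one tensor factor -/

section AtSite

variable {d ℓ : ℕ}

lemma atSite_mulVec (x : Box ℓ) (A : Matrix (Fin (d + 1)) (Fin (d + 1)) ℂ)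
    (ψ : Config d ℓ → ℂ) (σ : Config d ℓ) :
    (atSite x A *ᵥ ψ) σ = ∑ j, A (σ x) j * ψ (update σ x j) := by
  symm
  refine Fintype.sum_of_injective (fun j => update σ x j) (update_injective σ x) _ _ ?_ ?_
  · intro τ hτ
    have : ¬ ∀ y, y ≠ x → σ y = τ y := by
      intro h
      refine hτ ⟨τ x, ?_⟩
      ext1 y
      by_cases hy : y = x
      · subst hy; simp
      · simp [hy, h y hy]
    simp [atSite, this]
  · intro j
    have : ∀ y, y ≠ x → σ y = update σ x j y := fun y hy => by simp [hy]
    simp only [atSite, of_apply, if_pos this, update_self]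

lemma atSite_add (x : Box ℓ) (A B : Matrix (Fin (d + 1)) (Fin (d + 1)) ℂ) :
    atSite x (A + B) = atSite x A + atSite x B := by
  ext σ τ
  simp only [atSite, of_apply, Matrix.add_apply]
  split_ifs <;> simp

lemma atSite_smul (x : Box ℓ) (c : ℂ) (A : Matrix (Fin (d + 1)) (Fin (d + 1)) ℂ) :
    atSite x (c • A) = c • atSite x A := by
  ext σ τ
  by_cases h : ∀ y, y ≠ x → σ y = τ y <;> simp [atSite, h]

lemma atSite_sub (x : Box ℓ) (A B : Matrix (Fin (d + 1)) (Fin (d + 1)) ℂ) :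
    atSite x (A - B) = atSite x A - atSite x B := by
  ext σ τ
  simp only [atSite, of_apply, Matrix.sub_apply]
  split_ifs <;> simp

lemma atSite_conjTranspose (x : Box ℓ) (A : Matrix (Fin (d + 1)) (Fin (d + 1)) ℂ) :
    (atSite x A)ᴴ = atSite x Aᴴ := by
  ext σ τ
  by_cases h : ∀ y, y ≠ x → σ y = τ y
  · have h' : ∀ y, y ≠ x → τ y = σ y := fun y hy => (h y hy).symm
    simp only [atSite, conjTranspose_apply, of_apply, if_pos h, if_pos h']
  · have h' : ¬ ∀ y, y ≠ x → τ y = σ y := fun h' => h fun y hy => (h' y hy).symm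
    simp only [atSite, conjTranspose_apply, of_apply, if_neg h, if_neg h', star_zero]

lemma atSite_diagonal (x : Box ℓ) (f : Fin (d + 1) → ℂ) :
    atSite x (diagonal f) = diagonal fun σ => f (σ x) := by
  ext σ τ
  by_cases hστ : σ = τ
  · subst hστ; simp [atSite]
  · rw [diagonal_apply_ne _ hστ]
    by_cases h : ∀ y, y ≠ x → σ y = τ y
    · have : σ x ≠ τ x := fun hx => hστ <| funext fun y => by
        by_cases hy : y = x
        · rw [hy, hx]
        · exact h y hy
      simp [atSite, diagonal_apply_ne _ this]
    · simp [atSite, h]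

lemma atSite_mul (x : Box ℓ) (A B : Matrix (Fin (d + 1)) (Fin (d + 1)) ℂ) :
    atSite x A * atSite x B = atSite x (A * B) := by
  refine Matrix.ext_of_mulVec_single fun τ => ?_
  ext σ
  rw [← mulVec_mulVec, atSite_mulVec, atSite_mulVec]
  simp only [atSite_mulVec, update_self, update_idem, mul_apply, Finset.mul_sum, Finset.sum_mul]
  rw [Finset.sum_comm]
  simp only [mul_assoc]

lemma commute_atSite {x y : Box ℓ} (hxy : x ≠ y)
    (A B : Matrix (Fin (d + 1)) (Fin (d + 1)) ℂ) :
    Commute (atSite x A) (atSite y B) := by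
  refine Matrix.ext_of_mulVec_single fun τ => ?_
  ext σ
  rw [← mulVec_mulVec, ← mulVec_mulVec, atSite_mulVec, atSite_mulVec]
  simp only [atSite_mulVec, update_of_ne hxy, update_of_ne hxy.symm, Finset.mul_sum]
  rw [Finset.sum_comm]
  refine Finset.sum_congr rfl fun j _ => Finset.sum_congr rfl fun k _ => ?_
  rw [update_comm hxy]
  ring

end AtSite

end Heisenberg

namespace Heisenberg

open Matrix Function

/-! ### The one-site spin algebra -/

section OneSite

variable (d : ℕ)

lemma spinRaise_apply (i j : Fin (d + 1)) :
    spinRaise d i j = if (i : ℕ) = (j : ℕ) + 1 then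
      ((Real.sqrt (((d : ℝ) - (j : ℕ)) * ((j : ℕ) + 1)) : ℝ) : ℂ) else 0 := rfl

lemma spinMatrix_zero :
    spinMatrix d 0 = (1 / 2 : ℂ) • (spinRaise d + (spinRaise d)ᴴ) := rfl

lemma spinMatrix_one :
    spinMatrix d 1 = (1 / (2 * Complex.I) : ℂ) • (spinRaise d - (spinRaise d)ᴴ) := rfl

lemma spinMatrix_two :
    spinMatrix d 2 = diagonal fun i : Fin (d + 1) => ((((i : ℕ) : ℝ) - spin d : ℝ) : ℂ) := rfl

lemma spinZ_conjTranspose : (spinMatrix d 2)ᴴ = spinMatrix d 2 := by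
  rw [spinMatrix_two, diagonal_conjTranspose]
  congr 1
  ext i
  simp [Pi.star_apply]

lemma sqrt_mul_self_coe (i : Fin (d + 1)) :
    ((Real.sqrt (((d : ℝ) - (i : ℕ)) * ((i : ℕ) + 1)) : ℝ) : ℂ) *
      ((Real.sqrt (((d : ℝ) - (i : ℕ)) * ((i : ℕ) + 1)) : ℝ) : ℂ) =
      ((d : ℂ) - (i : ℕ)) * ((i : ℕ) + 1) := by
  have hi : ((i : ℕ) : ℝ) ≤ d := by exact_mod_cast Nat.lt_succ_iff.1 i.2
  rw [← Complex.ofReal_mul, Real.mul_self_sqrt (by nlinarith [(Nat.cast_nonneg i : (0:ℝ) ≤ (i:ℕ))])]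
  push_cast
  ring

lemma spinLower_mul_spinRaise :
    (spinRaise d)ᴴ * spinRaise d =
      diagonal fun j : Fin (d + 1) => ((d : ℂ) - (j : ℕ)) * ((j : ℕ) + 1) := by
  ext i j
  rw [mul_apply]
  simp only [conjTranspose_apply, spinRaise_apply]
  by_cases hij : i = j
  · subst hij
    rw [diagonal_apply_eq]
    by_cases hi : (i : ℕ) + 1 < d + 1
    · rw [Finset.sum_eq_single ⟨i + 1, hi⟩]
      · simp only [if_true, Complex.star_def, Complex.conj_ofReal]
        exact sqrt_mul_self_coe d i
      · intro k _ hk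
        have : ¬ (k : ℕ) = i + 1 := fun h => hk (Fin.ext h)
        simp [this]
      · simp
    -- The top state is annihilated, in agreement with the vanishing factor `d - i`.
    · have hid : (i : ℕ) = d := by have := i.2; omega
      rw [Finset.sum_eq_zero, hid]
      · simp
      · intro k _
        have : ¬ (k : ℕ) = i + 1 := by have := k.2; omega
        simp [this]
  · rw [diagonal_apply_ne _ hij]
    refine Finset.sum_eq_zero fun k _ => ?_
    by_cases h1 : (k : ℕ) = i + 1
    · have : ¬ (k : ℕ) = j + 1 := fun h => hij (Fin.ext (by omega))
      rw [if_neg this, mul_zero]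
    · rw [if_neg h1, star_zero, zero_mul]

lemma spinRaise_mul_spinLower :
    spinRaise d * (spinRaise d)ᴴ =
      diagonal fun i : Fin (d + 1) => ((d : ℂ) - (i : ℕ) + 1) * (i : ℕ) := by
  ext i j
  rw [mul_apply]
  simp only [conjTranspose_apply, spinRaise_apply]
  by_cases hij : i = j
  · subst hij
    rw [diagonal_apply_eq]
    by_cases hi : (i : ℕ) = 0
    · rw [Finset.sum_eq_zero, hi]
      · simp
      · intro k _
        have : ¬ (i : ℕ) = k + 1 := by omega
        simp [this]
    · have hi' : (i : ℕ) - 1 < d + 1 := by have := i.2; omega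
      have hi1 : (i : ℕ) = (i : ℕ) - 1 + 1 := by omega
      rw [Finset.sum_eq_single ⟨i - 1, hi'⟩]
      · simp only [Complex.star_def, Complex.conj_ofReal, if_pos hi1]
        have := sqrt_mul_self_coe d ⟨i - 1, hi'⟩
        simp only at this
        rw [this]
        push_cast [Nat.one_le_iff_ne_zero.2 hi]
        ring
      · intro k _ hk
        have : ¬ (i : ℕ) = k + 1 := fun h => hk (Fin.ext (by simp [h]))
        simp [this]
      · simp
  · rw [diagonal_apply_ne _ hij]
    refine Finset.sum_eq_zero fun k _ => ?_
    by_cases h1 : (i : ℕ) = k + 1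
    · have : ¬ (j : ℕ) = k + 1 := fun h => hij (Fin.ext (by omega))
      rw [if_neg this, star_zero, mul_zero]
    · rw [if_neg h1, zero_mul]

lemma spinRaise_commutator :
    spinRaise d * (spinRaise d)ᴴ - (spinRaise d)ᴴ * spinRaise d = (2 : ℂ) • spinMatrix d 2 := by
  rw [spinRaise_mul_spinLower, spinLower_mul_spinRaise, spinMatrix_two, diagonal_sub,
    ← diagonal_smul]
  congr 1
  ext i
  simp [spin]
  ring

lemma spinZ_spinRaise_commutator :
    spinMatrix d 2 * spinRaise d - spinRaise d * spinMatrix d 2 = spinRaise d := by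
  ext i j
  rw [spinMatrix_two, Matrix.sub_apply, diagonal_mul, mul_diagonal, spinRaise_apply]
  split_ifs with h
  · rw [h]; push_cast; ring
  · simp

lemma spin_casimir :
    (spinRaise d)ᴴ * spinRaise d + spinMatrix d 2 * spinMatrix d 2 + spinMatrix d 2 =
      ((spin d * (spin d + 1) : ℝ) : ℂ) • 1 := by
  rw [spinLower_mul_spinRaise, spinMatrix_two, diagonal_mul_diagonal, diagonal_add, diagonal_add,
    ← diagonal_one, ← diagonal_smul]
  congr 1
  ext i
  simp [spin]
  ring

end OneSite

/-! ### Invariance of the two-spin coupling -/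

section Pairs

variable {R : Type*} [Ring R]

/-- The isotropic coupling `2 z z' + p m' + m p'` of two commuting `sl₂` triples commutes with
the sum of the raising operators. -/
lemma commute_coupling_raise {p m z p' m' z' : R}
    (hpm : p * m - m * p = z + z) (hzp : z * p - p * z = p)
    (hpm' : p' * m' - m' * p' = z' + z') (hzp' : z' * p' - p' * z' = p')
    (hpp' : Commute p p') (hm'p : Commute m' p) (hz'p : Commute z' p)
    (hmp' : Commute m p') (hzp'' : Commute z p') :
    Commute (z * z' + z * z' + p * m' + m * p') (p + p') := by
  have e1 := hpp'.eq
  have e2 := hm'p.eq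
  have e3 := hz'p.eq
  have e4 := hmp'.eq
  have e5 := hzp''.eq
  unfold Commute SemiconjBy
  -- Cross-site relations only move factors past each other; the terms produced by the two same-site
  -- algebras cancel.
  linear_combination (norm := noncomm_ring) 2 * (z * e3) + 2 * (hzp * z') + 2 * (z * hzp')
    + 2 * (e5 * z') + p * e2 - p * hpm' + e1 * m' - m * e1 - hpm * p' + e4 * p'

end Pairs

end Heisenberg

namespace Heisenberg

open Matrix Function

/-! ### Ladder operators at the sites -/

section SiteOperators

variable {d ℓ : ℕ}

/-- The raising operator at the site `x`. -/
noncomputable def siteRaise (d : ℕ) {ℓ : ℕ} (x : Box ℓ) : Matrix (Config d ℓ) (Config d ℓ) ℂ :=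
  atSite x (spinRaise d)

/-- The lowering operator at the site `x`. -/
noncomputable def siteLower (d : ℕ) {ℓ : ℕ} (x : Box ℓ) : Matrix (Config d ℓ) (Config d ℓ) ℂ :=
  atSite x (spinRaise d)ᴴ

/-- The third spin component at the site `x`. -/
noncomputable def siteZ (d : ℕ) {ℓ : ℕ} (x : Box ℓ) : Matrix (Config d ℓ) (Config d ℓ) ℂ :=
  atSite x (spinMatrix d 2)

lemma siteRaise_conjTranspose (x : Box ℓ) : (siteRaise d x)ᴴ = siteLower d x :=
  atSite_conjTranspose _ _

lemma siteLower_conjTranspose (x : Box ℓ) : (siteLower d x)ᴴ = siteRaise d x := by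
  rw [siteLower, atSite_conjTranspose, conjTranspose_conjTranspose, siteRaise]

lemma siteZ_conjTranspose (x : Box ℓ) : (siteZ d x)ᴴ = siteZ d x := by
  rw [siteZ, atSite_conjTranspose, spinZ_conjTranspose]

lemma siteZ_eq_diagonal (x : Box ℓ) :
    siteZ d x = diagonal fun σ : Config d ℓ => ((((σ x : ℕ) : ℝ) - spin d : ℝ) : ℂ) := by
  rw [siteZ, spinMatrix_two, atSite_diagonal]

lemma siteRaise_commutator (x : Box ℓ) :
    siteRaise d x * siteLower d x - siteLower d x * siteRaise d x = siteZ d x + siteZ d x := by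
  rw [siteRaise, siteLower, siteZ, atSite_mul, atSite_mul, ← atSite_sub, spinRaise_commutator,
    atSite_smul, two_smul]

lemma siteZ_siteRaise_commutator (x : Box ℓ) :
    siteZ d x * siteRaise d x - siteRaise d x * siteZ d x = siteRaise d x := by
  rw [siteRaise, siteZ, atSite_mul, atSite_mul, ← atSite_sub, spinZ_spinRaise_commutator]

lemma atSite_one (x : Box ℓ) :
    atSite x (1 : Matrix (Fin (d + 1)) (Fin (d + 1)) ℂ) = 1 := by
  rw [← diagonal_one, atSite_diagonal, diagonal_one]

lemma site_casimir (x : Box ℓ) :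
    siteLower d x * siteRaise d x + siteZ d x * siteZ d x + siteZ d x =
      ((spin d * (spin d + 1) : ℝ) : ℂ) • 1 := by
  rw [siteRaise, siteLower, siteZ, atSite_mul, atSite_mul, ← atSite_add, ← atSite_add, spin_casimir,
    atSite_smul, atSite_one]

lemma atSite_spinMatrix_zero (x : Box ℓ) :
    atSite x (spinMatrix d 0) = (1 / 2 : ℂ) • (siteRaise d x + siteLower d x) := by
  rw [spinMatrix_zero, atSite_smul, atSite_add, siteRaise, siteLower]

lemma atSite_spinMatrix_one (x : Box ℓ) :
    atSite x (spinMatrix d 1) =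
      (1 / (2 * Complex.I) : ℂ) • (siteRaise d x - siteLower d x) := by
  rw [spinMatrix_one, atSite_smul, atSite_sub, siteRaise, siteLower]

/-- The products `p * p'` and `m * m'` cancel because (1/2i)² = -1/4. It serves both single sites
and total spins. -/
lemma half_smul_mul_add_smul_mul {R : Type*} [Ring R] [Algebra ℂ R] (p m p' m' : R) :
    ((1 / 2 : ℂ) • (p + m)) * ((1 / 2 : ℂ) • (p' + m')) +
      ((1 / (2 * Complex.I) : ℂ) • (p - m)) * ((1 / (2 * Complex.I) : ℂ) • (p' - m')) =
    (1 / 2 : ℂ) • (p * m' + m * p') := by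
  have h : (1 / (2 * Complex.I) : ℂ) * (1 / (2 * Complex.I)) = -(1 / 4) := by
    have := Complex.I_mul_I
    rw [div_mul_div_comm, show 2 * Complex.I * (2 * Complex.I) = -4 by
      linear_combination (4 : ℂ) * this]
    norm_num
  rw [smul_mul_smul_comm, smul_mul_smul_comm, h, mul_add, add_mul, add_mul, mul_sub, sub_mul,
    sub_mul]
  module

lemma spinDot_eq (x y : Box ℓ) :
    spinDot d x y = (1 / 2 : ℂ) • (siteZ d x * siteZ d y + siteZ d x * siteZ d y +
      siteRaise d x * siteLower d y + siteLower d x * siteRaise d y) := by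
  rw [spinDot, Fin.sum_univ_three, atSite_spinMatrix_zero, atSite_spinMatrix_zero,
    atSite_spinMatrix_one, atSite_spinMatrix_one, half_smul_mul_add_smul_mul, ← siteZ, ← siteZ]
  module

lemma spinDot_conjTranspose {x y : Box ℓ} (hxy : x ≠ y) :
    (spinDot d x y)ᴴ = spinDot d x y := by
  have h1 : siteZ d y * siteZ d x = siteZ d x * siteZ d y := (commute_atSite hxy.symm _ _).eq
  have h2 : siteLower d y * siteRaise d x = siteRaise d x * siteLower d y :=
    (commute_atSite hxy.symm _ _).eq
  have h3 : siteRaise d y * siteLower d x = siteLower d x * siteRaise d y :=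
    (commute_atSite hxy.symm _ _).eq
  have h4 : star (1 / 2 : ℂ) = 1 / 2 := by simp
  rw [spinDot_eq, conjTranspose_smul, h4]
  simp only [conjTranspose_add, conjTranspose_mul, siteRaise_conjTranspose,
    siteLower_conjTranspose, siteZ_conjTranspose, h1, h2, h3]
  module

lemma spinDot_self (x : Box ℓ) :
    spinDot d x x = ((spin d * (spin d + 1) : ℝ) : ℂ) • 1 := by
  rw [← site_casimir, spinDot_eq, eq_add_of_sub_eq (siteRaise_commutator x)]
  module

end SiteOperators

/-! ### Total spin and its commutation with the Hamiltonian -/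

section Totals

variable (d ℓ : ℕ)

/-- The raising operator of the total spin. -/
noncomputable def totalRaise : Matrix (Config d ℓ) (Config d ℓ) ℂ := ∑ x, siteRaise d x

/-- The lowering operator of the total spin. -/
noncomputable def totalLower : Matrix (Config d ℓ) (Config d ℓ) ℂ := ∑ x, siteLower d x

/-- The third component of the total spin. -/
noncomputable def totalZ : Matrix (Config d ℓ) (Config d ℓ) ℂ := ∑ x, siteZ d x

lemma totalRaise_conjTranspose : (totalRaise d ℓ)ᴴ = totalLower d ℓ := by
  simp [totalRaise, totalLower, conjTranspose_sum, siteRaise_conjTranspose]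

lemma totalLower_conjTranspose : (totalLower d ℓ)ᴴ = totalRaise d ℓ := by
  simp [totalRaise, totalLower, conjTranspose_sum, siteLower_conjTranspose]

variable {d ℓ}

lemma sum_commutator_sum {R X : Type*} [Ring R] [Fintype X] (f g h : X → R)
    (hne : ∀ x y, x ≠ y → Commute (f x) (g y)) (heq : ∀ x, f x * g x - g x * f x = h x) :
    (∑ x, f x) * (∑ x, g x) - (∑ x, g x) * (∑ x, f x) = ∑ x, h x := by
  classical
  rw [Finset.sum_mul_sum, Finset.sum_mul_sum, Finset.sum_comm (γ := X) (f := fun i j => g i * f j),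
    ← Finset.sum_sub_distrib]
  refine Finset.sum_congr rfl fun x _ => ?_
  rw [← Finset.sum_sub_distrib, Finset.sum_eq_single x, heq]
  · intro y _ hy
    rw [(hne x y hy.symm).eq, sub_self]
  · simp

lemma totalRaise_commutator :
    totalRaise d ℓ * totalLower d ℓ - totalLower d ℓ * totalRaise d ℓ =
      totalZ d ℓ + totalZ d ℓ := by
  rw [totalZ, ← Finset.sum_add_distrib]
  exact sum_commutator_sum _ _ _ (fun x y hxy => commute_atSite hxy _ _) siteRaise_commutator

lemma totalZ_totalRaise_commutator :
    totalZ d ℓ * totalRaise d ℓ - totalRaise d ℓ * totalZ d ℓ = totalRaise d ℓ := by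
  exact sum_commutator_sum _ _ _ (fun x y hxy => commute_atSite hxy _ _) siteZ_siteRaise_commutator

lemma totalSpinSqMatrix_eq_sum_spinDot :
    totalSpinSqMatrix d ℓ = ∑ x : Box ℓ, ∑ y : Box ℓ, spinDot d x y := by
  simp only [totalSpinSqMatrix, spinDot, sq, Finset.sum_mul_sum]
  rw [Finset.sum_comm]
  exact Finset.sum_congr rfl fun x _ => Finset.sum_comm

lemma totalSpinSqMatrix_eq :
    totalSpinSqMatrix d ℓ =
      totalLower d ℓ * totalRaise d ℓ + totalZ d ℓ * totalZ d ℓ + totalZ d ℓ := by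
  simp only [totalSpinSqMatrix, Fin.sum_univ_three, atSite_spinMatrix_zero, atSite_spinMatrix_one,
    ← Finset.smul_sum, Finset.sum_add_distrib, Finset.sum_sub_distrib, sq]
  rw [← totalRaise, ← totalLower, half_smul_mul_add_smul_mul,
    eq_add_of_sub_eq totalRaise_commutator]
  change _ + totalZ d ℓ * totalZ d ℓ = _
  module

/-- Sites outside the pair commute trivially; the pair itself is `commute_coupling_raise`. -/
lemma commute_spinDot_totalRaise {x y : Box ℓ} (hxy : x ≠ y) :
    Commute (spinDot d x y) (totalRaise d ℓ) := by
  have key : Commute (spinDot d x y) (siteRaise d x + siteRaise d y) := by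
    rw [spinDot_eq]
    exact (commute_coupling_raise (siteRaise_commutator x) (siteZ_siteRaise_commutator x)
      (siteRaise_commutator y) (siteZ_siteRaise_commutator y) (commute_atSite hxy _ _)
      (commute_atSite hxy.symm _ _) (commute_atSite hxy.symm _ _) (commute_atSite hxy _ _)
      (commute_atSite hxy _ _)).smul_left _
  rw [totalRaise, ← Finset.sum_sdiff (Finset.subset_univ {x, y}), Finset.sum_pair hxy]
  refine Commute.add_right (Commute.sum_right _ _ _ fun w hw => ?_) key
  simp only [Finset.mem_sdiff, Finset.mem_univ, Finset.mem_insert, Finset.mem_singleton,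
    true_and, not_or] at hw
  have hx : ∀ A B : Matrix (Fin (d + 1)) (Fin (d + 1)) ℂ, Commute (atSite x A) (atSite w B) :=
    fun A B => commute_atSite (Ne.symm hw.1) A B
  have hy : ∀ A B : Matrix (Fin (d + 1)) (Fin (d + 1)) ℂ, Commute (atSite y A) (atSite w B) :=
    fun A B => commute_atSite (Ne.symm hw.2) A B
  rw [spinDot]
  exact Commute.sum_left _ _ _ fun a _ => (hx _ _).mul_left (hy _ _)

lemma Adj.ne {x y : Box ℓ} (h : Adj x y) : x ≠ y := by
  rintro rfl
  simp [Adj] at h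

lemma hamiltonianMatrix_conjTranspose : (hamiltonianMatrix d ℓ)ᴴ = hamiltonianMatrix d ℓ := by
  have h4 : star (1 / 2 : ℂ) = 1 / 2 := by simp
  rw [hamiltonianMatrix, conjTranspose_smul, h4]
  simp only [conjTranspose_sum]
  congr 1
  refine Finset.sum_congr rfl fun x _ => Finset.sum_congr rfl fun y _ => ?_
  split_ifs with h
  · rw [conjTranspose_sub, spinDot_conjTranspose h.ne, conjTranspose_smul, conjTranspose_one,
      Complex.star_def, Complex.conj_ofReal]
  · exact conjTranspose_zero

lemma commute_hamiltonianMatrix_totalRaise :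
    Commute (hamiltonianMatrix d ℓ) (totalRaise d ℓ) := by
  refine Commute.smul_left (Commute.sum_left _ _ _ fun x _ => Commute.sum_left _ _ _ fun y _ => ?_) _
  split_ifs with h
  · exact ((Commute.one_left _).smul_left _).sub_left (commute_spinDot_totalRaise h.ne)
  · exact Commute.zero_left _

lemma commute_hamiltonianMatrix_totalLower :
    Commute (hamiltonianMatrix d ℓ) (totalLower d ℓ) := by
  have h := congrArg conjTranspose (commute_hamiltonianMatrix_totalRaise (d := d) (ℓ := ℓ)).eq
  rw [conjTranspose_mul, conjTranspose_mul, totalRaise_conjTranspose,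
    hamiltonianMatrix_conjTranspose] at h
  exact h.symm

lemma commute_hamiltonianMatrix_totalZ :
    Commute (hamiltonianMatrix d ℓ) (totalZ d ℓ) := by
  have hR := commute_hamiltonianMatrix_totalRaise (d := d) (ℓ := ℓ)
  have hL := commute_hamiltonianMatrix_totalLower (d := d) (ℓ := ℓ)
  have h2 : Commute (hamiltonianMatrix d ℓ) (totalZ d ℓ + totalZ d ℓ) := by
    rw [← totalRaise_commutator]
    exact (hR.mul_right hL).sub_right (hL.mul_right hR)
  have h3 : totalZ d ℓ = (1 / 2 : ℂ) • (totalZ d ℓ + totalZ d ℓ) := by module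
  rw [h3]
  exact h2.smul_right _

lemma commute_hamiltonianMatrix_totalSpinSqMatrix :
    Commute (hamiltonianMatrix d ℓ) (totalSpinSqMatrix d ℓ) := by
  have hZ := commute_hamiltonianMatrix_totalZ (d := d) (ℓ := ℓ)
  rw [totalSpinSqMatrix_eq]
  exact ((commute_hamiltonianMatrix_totalLower.mul_right
    commute_hamiltonianMatrix_totalRaise).add_right (hZ.mul_right hZ)).add_right hZ

lemma totalZ_eq_diagonal :
    totalZ d ℓ =
      diagonal fun σ : Config d ℓ =>
        (((∑ x, (σ x : ℕ) : ℕ) - spin d * (ℓ : ℝ) ^ 3 : ℝ) : ℂ) := by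
  ext σ τ
  rw [totalZ, Matrix.sum_apply]
  simp only [siteZ_eq_diagonal]
  by_cases h : σ = τ
  · subst h
    simp [Finset.sum_sub_distrib]
    ring
  · simp [diagonal_apply_ne _ h]

end Totals

end Heisenberg

namespace Heisenberg

open Function

/-! ### Pair energies in the two-boson picture -/

section PairEnergy

variable {X : Type*} [DecidableEq X]

/-- The annihilation operator `a_x b_y - b_x a_y` of a singlet on the pair `x, y` in the
two-boson representation of spins, where `n x` is the number of `a`-bosons at the site `x` and
`d - n x` the number of `b`-bosons. -/
noncomputable def pairLower (d : ℕ) (x y : X) (Ψ : (X → ℕ) → ℂ) (n : X → ℕ) : ℂ :=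
  ((√((n x : ℝ) + 1) * √((d : ℝ) - n y) : ℝ) : ℂ) * Ψ (n + Pi.single x 1) -
    ((√((d : ℝ) - n x) * √((n y : ℝ) + 1) : ℝ) : ℂ) * Ψ (n + Pi.single y 1)

/-- The squared norm of `pairLower d x y Ψ`. -/
noncomputable def pairEnergy (d : ℕ) (x y : X) (Ψ : (X → ℕ) → ℂ) : ℝ :=
  ∑' n, ‖pairLower d x y Ψ n‖ ^ 2

/-- The wave function `Ψ` vanishes on configurations with more than `d` particles at a site. -/
def SupportedBelow (d : ℕ) {E : Type*} [Zero E] (Ψ : (X → ℕ) → E) : Prop :=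
  ∀ n, Ψ n ≠ 0 → ∀ x, n x ≤ d

lemma SupportedBelow.summable [Finite X] {d : ℕ} {f : (X → ℕ) → ℝ}
    (hf : SupportedBelow d f) : Summable f := by
  have := Fintype.ofFinite X
  refine summable_of_hasFiniteSupport ((Set.finite_Iic (fun _ : X => d)).subset fun n hn => ?_)
  exact fun x => hf n hn x

omit [DecidableEq X] in
lemma SupportedBelow.apply_add_eq_zero {d : ℕ} {Ψ : (X → ℕ) → ℂ} (hΨ : SupportedBelow d Ψ)
    {n m : X → ℕ} {x : X} (hx : d < n x + m x) : Ψ (n + m) = 0 := by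
  by_contra h
  exact absurd (hΨ _ h x) (by simpa using hx)

omit [DecidableEq X] in
lemma SupportedBelow.apply_eq_zero {d : ℕ} {Ψ : (X → ℕ) → ℂ} (hΨ : SupportedBelow d Ψ)
    {n : X → ℕ} {x : X} (hx : d < n x) : Ψ n = 0 := by
  by_contra h
  exact absurd (hΨ _ h x) (by omega)

lemma SupportedBelow.pairLower {d : ℕ} {Ψ : (X → ℕ) → ℂ} (hΨ : SupportedBelow d Ψ) (x y : X) :
    SupportedBelow d (pairLower d x y Ψ) := by
  intro n hn w
  by_contra! hw
  refine hn ?_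
  rw [Heisenberg.pairLower, hΨ.apply_add_eq_zero (x := w) (by omega),
    hΨ.apply_add_eq_zero (x := w) (by omega)]
  simp

/-- The shift misses only configurations with `n x = 0`, which have weight zero. -/
lemma tsum_shift (x : X) (g : (X → ℕ) → ℝ) :
    ∑' n : X → ℕ, ((n x : ℝ) + 1) * g (n + Pi.single x 1) = ∑' n : X → ℕ, (n x : ℝ) * g n := by
  have hinj : Injective fun n : X → ℕ => n + Pi.single x 1 := add_left_injective _
  rw [← hinj.tsum_eq (f := fun n : X → ℕ => (n x : ℝ) * g n)]
  · simp
  · intro n hn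
    have hn0 : n x ≠ 0 := by
      intro h
      simp [h] at hn
    refine ⟨n - Pi.single x 1, ?_⟩
    ext w
    by_cases hw : w = x
    · subst hw
      simp
      omega
    · simp [hw]

/-- The density of the number operator at the site `y` on the state `φ`, split according to
which of the two kinds of bosons is removed. -/
noncomputable def siteDensity (d : ℕ) (y : X) (φ : (X → ℕ) → ℂ) (n : X → ℕ) : ℝ :=
  ‖(√((n y : ℝ) + 1) : ℂ) * φ (n + Pi.single y 1)‖ ^ 2 + ‖(√((d : ℝ) - n y) : ℂ) * φ n‖ ^ 2

lemma norm_sqrt_mul_sq {r : ℝ} (hr : 0 ≤ r) (z : ℂ) : ‖(√r : ℂ) * z‖ ^ 2 = r * ‖z‖ ^ 2 := by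
  rw [norm_mul, mul_pow, Complex.norm_real, Real.norm_eq_abs, sq_abs, Real.sq_sqrt hr]

lemma siteDensity_eq {d : ℕ} {φ : (X → ℕ) → ℂ} (hφ : SupportedBelow d φ) (y : X) (n : X → ℕ) :
    siteDensity d y φ n =
      ((n y : ℝ) + 1) * ‖φ (n + Pi.single y 1)‖ ^ 2 + ((d : ℝ) - n y) * ‖φ n‖ ^ 2 := by
  rw [siteDensity, norm_sqrt_mul_sq (by positivity)]
  by_cases h : n y ≤ d
  · rw [norm_sqrt_mul_sq (sub_nonneg.2 (by exact_mod_cast h))]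
  · rw [hφ.apply_eq_zero (x := y) (not_le.1 h)]
    simp

lemma SupportedBelow.siteDensity {d : ℕ} {φ : (X → ℕ) → ℂ} (hφ : SupportedBelow d φ) (y : X) :
    SupportedBelow d (siteDensity d y φ) := by
  intro n hn w
  by_contra! hw
  refine hn ?_
  rw [siteDensity_eq hφ, hφ.apply_add_eq_zero (x := w) (by omega), hφ.apply_eq_zero (x := w) hw]
  simp

/-- The two boson numbers at `y`, `n y` and `d - n y`, add up to `d`. -/
lemma tsum_siteDensity [Finite X] {d : ℕ} {φ : (X → ℕ) → ℂ} (hφ : SupportedBelow d φ) (y : X) :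
    ∑' n, siteDensity d y φ n = d * ∑' n, ‖φ n‖ ^ 2 := by
  have h1 : Summable fun n : X → ℕ => ((n y : ℝ) + 1) * ‖φ (n + Pi.single y 1)‖ ^ 2 := by
    refine SupportedBelow.summable (d := d) fun n hn w => ?_
    by_contra! hw
    exact hn (by rw [hφ.apply_add_eq_zero (x := w) (by omega)]; simp)
  have h2 (c : (X → ℕ) → ℝ) : Summable fun n : X → ℕ => c n * ‖φ n‖ ^ 2 := by
    refine SupportedBelow.summable (d := d) fun n hn w => ?_
    by_contra! hw
    exact hn (by rw [hφ.apply_eq_zero (x := w) hw]; simp)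
  simp only [siteDensity_eq hφ]
  rw [h1.tsum_add (h2 _), tsum_shift y (fun n => ‖φ n‖ ^ 2), ← (h2 _).tsum_add (h2 _),
    ← tsum_mul_left]
  congr 1
  ext n
  ring

/-- The exchange identity a_y A_xz = a_z A_xy + a_x A_yz. -/
lemma mul_pairLower_add_single {d : ℕ} {x y z : X} (hxy : x ≠ y) (hyz : y ≠ z) (hxz : x ≠ z)
    (Ψ : (X → ℕ) → ℂ) (n : X → ℕ) :
    (√((n y : ℝ) + 1) : ℂ) * pairLower d x z Ψ (n + Pi.single y 1) =
      (√((n z : ℝ) + 1) : ℂ) * pairLower d x y Ψ (n + Pi.single z 1) +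
        (√((n x : ℝ) + 1) : ℂ) * pairLower d y z Ψ (n + Pi.single x 1) := by
  have h1 := add_right_comm n (Pi.single y 1) (Pi.single x 1)
  have h2 := add_right_comm n (Pi.single z 1) (Pi.single x 1)
  have h3 := add_right_comm n (Pi.single z 1) (Pi.single y 1)
  simp only [pairLower, h1, h2, h3, Pi.add_apply, Pi.single_eq_of_ne hxy, Pi.single_eq_of_ne hyz,
    Pi.single_eq_of_ne hxz, Pi.single_eq_of_ne hxy.symm, Pi.single_eq_of_ne hyz.symm,
    Pi.single_eq_of_ne hxz.symm, add_zero, Complex.ofReal_mul]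
  ring

/-- The same identity for b. Removing a b-boson does not shift `n`, so it is pure algebra, even for
coinciding sites. -/
lemma mul_pairLower {d : ℕ} (x y z : X) (Ψ : (X → ℕ) → ℂ) (n : X → ℕ) :
    (√((d : ℝ) - n y) : ℂ) * pairLower d x z Ψ n =
      (√((d : ℝ) - n z) : ℂ) * pairLower d x y Ψ n +
        (√((d : ℝ) - n x) : ℂ) * pairLower d y z Ψ n := by
  simp only [pairLower, Complex.ofReal_mul]
  ring

lemma norm_add_sq_le_weighted {t : ℝ} (ht : 0 < t) (u v : ℂ) :
    ‖u + v‖ ^ 2 ≤ (1 + t) * ‖u‖ ^ 2 + (1 + t⁻¹) * ‖v‖ ^ 2 := by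
  have h1 : ‖u + v‖ ^ 2 ≤ (‖u‖ + ‖v‖) ^ 2 := by gcongr; exact norm_add_le u v
  have h2 : (1 + t) * ‖u‖ ^ 2 + (1 + t⁻¹) * ‖v‖ ^ 2 - (‖u‖ + ‖v‖) ^ 2 =
      t⁻¹ * (t * ‖u‖ - ‖v‖) ^ 2 := by
    field_simp
    ring
  have h3 : 0 ≤ t⁻¹ * (t * ‖u‖ - ‖v‖) ^ 2 := by positivity
  linarith

lemma pairEnergy_nonneg (d : ℕ) (x y : X) (Ψ : (X → ℕ) → ℂ) : 0 ≤ pairEnergy d x y Ψ :=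
  tsum_nonneg fun _ => by positivity

lemma pairEnergy_self (d : ℕ) (x : X) (Ψ : (X → ℕ) → ℂ) : pairEnergy d x x Ψ = 0 := by
  have : ∀ n, pairLower d x x Ψ n = 0 := fun n => by
    rw [pairLower, mul_comm √((n x : ℝ) + 1), sub_self]
  simp [pairEnergy, this]

lemma pairEnergy_comm (d : ℕ) (x y : X) (Ψ : (X → ℕ) → ℂ) :
    pairEnergy d x y Ψ = pairEnergy d y x Ψ := by
  have : ∀ n, pairLower d x y Ψ n = -pairLower d y x Ψ n := fun n => by
    simp only [pairLower, Complex.ofReal_mul]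
    ring
  simp [pairEnergy, this]

lemma SupportedBelow.summable_norm_sq [Finite X] {d : ℕ} {φ : (X → ℕ) → ℂ}
    (hφ : SupportedBelow d φ) : Summable fun n => ‖φ n‖ ^ 2 := by
  refine SupportedBelow.summable (d := d) fun n hn w => hφ n (fun h => hn ?_) w
  simp [h]

/-- The square root of the pair energy satisfies the triangle inequality, here in its weighted
quadratic form. -/
lemma pairEnergy_triangle [Finite X] {d : ℕ} (hd : 0 < d) {Ψ : (X → ℕ) → ℂ}
    (hΨ : SupportedBelow d Ψ) {t : ℝ} (ht : 0 < t) (x y z : X) :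
    pairEnergy d x z Ψ ≤ (1 + t) * pairEnergy d x y Ψ + (1 + t⁻¹) * pairEnergy d y z Ψ := by
  have hxy0 := pairEnergy_nonneg d x y Ψ
  have hyz0 := pairEnergy_nonneg d y z Ψ
  have hti : 0 < t⁻¹ := inv_pos.2 ht
  -- The exchange identity needs three distinct sites; if two coincide, one of the pair energies is
  -- zero.
  by_cases hxz : x = z
  · rw [hxz, pairEnergy_self, ← hxz]
    exact add_nonneg (mul_nonneg (by positivity) hxy0)
      (mul_nonneg (by positivity) (pairEnergy_nonneg _ _ _ _))
  by_cases hxy : x = y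
  · rw [hxy, pairEnergy_self]
    nlinarith
  by_cases hyz : y = z
  · rw [hyz, pairEnergy_self, ← hyz]
    nlinarith
  have hd' : (0 : ℝ) < d := by exact_mod_cast hd
  -- The factor `d` lets each pair energy be read as the boson number at the third site.
  refine le_of_mul_le_mul_left ?_ hd'
  have e1 := tsum_siteDensity (hΨ.pairLower x z) y
  have e2 := tsum_siteDensity (hΨ.pairLower x y) z
  have e3 := tsum_siteDensity (hΨ.pairLower y z) x
  have s1 := ((hΨ.pairLower x z).siteDensity y).summable
  have s2 := ((hΨ.pairLower x y).siteDensity z).summable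
  have s3 := ((hΨ.pairLower y z).siteDensity x).summable
  have key : ∑' n, siteDensity d y (pairLower d x z Ψ) n ≤
      ∑' n, ((1 + t) * siteDensity d z (pairLower d x y Ψ) n +
        (1 + t⁻¹) * siteDensity d x (pairLower d y z Ψ) n) := by
    refine s1.tsum_le_tsum (fun n => ?_) ((s2.mul_left _).add (s3.mul_left _))
    rw [siteDensity, siteDensity, siteDensity, mul_pairLower_add_single hxy hyz hxz,
      mul_pairLower x y z]
    have h1 := norm_add_sq_le_weighted ht
      ((√((n z : ℝ) + 1) : ℂ) * pairLower d x y Ψ (n + Pi.single z 1))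
      ((√((n x : ℝ) + 1) : ℂ) * pairLower d y z Ψ (n + Pi.single x 1))
    have h2 := norm_add_sq_le_weighted ht
      ((√((d : ℝ) - n z) : ℂ) * pairLower d x y Ψ n)
      ((√((d : ℝ) - n x) : ℂ) * pairLower d y z Ψ n)
    linarith
  rw [(s2.mul_left _).tsum_add (s3.mul_left _), tsum_mul_left, tsum_mul_left, e1, e2, e3] at key
  simp only [pairEnergy]
  linarith

/-- The squares are shifted back to `n`; the cross term, with its roots regrouped by site, is the
inner product of the states lowered at `x` and at `y`. -/
lemma pairEnergy_expand [Finite X] {d : ℕ} {Ψ : (X → ℕ) → ℂ}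
    (hΨ : SupportedBelow d Ψ) {x y : X} (hxy : x ≠ y) :
    pairEnergy d x y Ψ =
      ∑' n : X → ℕ, ((n x : ℝ) * (d - n y) + n y * (d - n x)) * ‖Ψ n‖ ^ 2 -
      2 * ∑' n : X → ℕ, (star
        (((√((d : ℝ) - n x) * √((n x : ℝ) + 1) : ℝ) : ℂ) * Ψ (n + Pi.single x 1)) *
        (((√((d : ℝ) - n y) * √((n y : ℝ) + 1) : ℝ) : ℂ) * Ψ (n + Pi.single y 1))).re := by
  have hs (c : (X → ℕ) → ℝ) (w : X) :
      Summable fun n : X → ℕ => c n * ‖Ψ (n + Pi.single w 1)‖ ^ 2 := by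
    refine SupportedBelow.summable (d := d) fun n hn w => ?_
    by_contra! hw
    exact hn (by rw [hΨ.apply_add_eq_zero (x := w) (by omega)]; simp)
  have hs' (c : (X → ℕ) → ℝ) : Summable fun n : X → ℕ => c n * ‖Ψ n‖ ^ 2 := by
    refine SupportedBelow.summable (d := d) fun n hn w => ?_
    by_contra! hw
    exact hn (by rw [hΨ.apply_eq_zero (x := w) hw]; simp)
  have hc : Summable fun n : X → ℕ => (star
        (((√((d : ℝ) - n x) * √((n x : ℝ) + 1) : ℝ) : ℂ) * Ψ (n + Pi.single x 1)) *
        (((√((d : ℝ) - n y) * √((n y : ℝ) + 1) : ℝ) : ℂ) * Ψ (n + Pi.single y 1))).re := by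
    refine SupportedBelow.summable (d := d) fun n hn w => ?_
    by_contra! hw
    exact hn (by rw [hΨ.apply_add_eq_zero (m := Pi.single x 1) (x := w) (by omega)]; simp)
  have hpt : ∀ n, ‖pairLower d x y Ψ n‖ ^ 2 =
      ((n x : ℝ) + 1) * (((d : ℝ) - n y) * ‖Ψ (n + Pi.single x 1)‖ ^ 2) +
      ((n y : ℝ) + 1) * (((d : ℝ) - n x) * ‖Ψ (n + Pi.single y 1)‖ ^ 2) -
      2 * (star (((√((d : ℝ) - n x) * √((n x : ℝ) + 1) : ℝ) : ℂ) * Ψ (n + Pi.single x 1)) *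
        (((√((d : ℝ) - n y) * √((n y : ℝ) + 1) : ℝ) : ℂ) * Ψ (n + Pi.single y 1))).re := by
    intro n
    -- Beyond `d` the real square root is truncated to zero, but there `Ψ` vanishes as well.
    by_cases h : n x ≤ d ∧ n y ≤ d
    · have hx := Real.sq_sqrt (sub_nonneg.2 (by exact_mod_cast h.1 : (n x : ℝ) ≤ d))
      have hy := Real.sq_sqrt (sub_nonneg.2 (by exact_mod_cast h.2 : (n y : ℝ) ≤ d))
      have hx1 := Real.sq_sqrt (by positivity : 0 ≤ (n x : ℝ) + 1)
      have hy1 := Real.sq_sqrt (by positivity : 0 ≤ (n y : ℝ) + 1)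
      rw [← hx, ← hy, ← hx1, ← hy1]
      simp only [Real.sqrt_sq (Real.sqrt_nonneg _), pairLower]
      simp only [← Complex.normSq_eq_norm_sq, Complex.normSq_apply, Complex.sub_re, Complex.sub_im,
        Complex.mul_re, Complex.mul_im, Complex.ofReal_re, Complex.ofReal_im, Complex.star_def,
        Complex.conj_re, Complex.conj_im]
      ring
    · have h1 : ∀ w, Ψ (n + Pi.single w 1) = 0 := fun w => by
        rcases not_and_or.1 h with h | h
        · exact hΨ.apply_add_eq_zero (x := x) (by omega)
        · exact hΨ.apply_add_eq_zero (x := y) (by omega)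
      simp [pairLower, h1]
  rw [pairEnergy]
  simp only [hpt]
  have a1 : Summable fun n : X → ℕ =>
      ((n x : ℝ) + 1) * (((d : ℝ) - n y) * ‖Ψ (n + Pi.single x 1)‖ ^ 2) := by
    simpa only [mul_assoc] using hs (fun n => ((n x : ℝ) + 1) * ((d : ℝ) - n y)) x
  have a2 : Summable fun n : X → ℕ =>
      ((n y : ℝ) + 1) * (((d : ℝ) - n x) * ‖Ψ (n + Pi.single y 1)‖ ^ 2) := by
    simpa only [mul_assoc] using hs (fun n => ((n y : ℝ) + 1) * ((d : ℝ) - n x)) y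
  have b1 := tsum_shift x (fun n : X → ℕ => ((d : ℝ) - n y) * ‖Ψ n‖ ^ 2)
  have b2 := tsum_shift y (fun n : X → ℕ => ((d : ℝ) - n x) * ‖Ψ n‖ ^ 2)
  simp only [Pi.add_apply, Pi.single_eq_of_ne hxy, Pi.single_eq_of_ne hxy.symm, add_zero]
    at b1 b2
  rw [(a1.add a2).tsum_sub (hc.mul_left 2), a1.tsum_add a2, b1, b2, tsum_mul_left]
  congr 1
  simp only [← mul_assoc]
  rw [← (hs' _).tsum_add (hs' _)]
  congr 1
  ext n
  ring

end PairEnergy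

end Heisenberg

/-! ### A Poincaré inequality for squared pseudometrics -/

namespace Heisenberg

open Function

/-- `K` is the square of a pseudometric; the triangle inequality is stated in its weighted
quadratic form. -/
structure IsSqDist {X : Type*} (K : X → X → ℝ) : Prop where
  nonneg : ∀ x y, 0 ≤ K x y
  self : ∀ x, K x x = 0
  comm : ∀ x y, K x y = K y x
  triangle : ∀ t : ℝ, 0 < t → ∀ x y z, K x z ≤ (1 + t) * K x y + (1 + t⁻¹) * K y z

namespace IsSqDist

section Path

variable {X : Type*} {K : X → X → ℝ}

/-- Cauchy–Schwarz along a path: the weight `t = 1 / n` in the induction step turns the factor `n`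
into `n + 1`. -/
lemma le_path (hK : IsSqDist K) (p : ℕ → X) (n : ℕ) :
    K (p 0) (p n) ≤ n * ∑ k ∈ Finset.range n, K (p k) (p (k + 1)) := by
  induction n with
  | zero => simp [hK.self]
  | succ n ih =>
    rcases Nat.eq_zero_or_pos n with rfl | hn
    · simp
    · have hn' : (0 : ℝ) < n := by exact_mod_cast hn
      have h := hK.triangle (n : ℝ)⁻¹ (inv_pos.2 hn') (p 0) (p n) (p (n + 1))
      rw [inv_inv] at h
      have h1 : (1 + (n : ℝ)⁻¹) * K (p 0) (p n) ≤
          (1 + (n : ℝ)⁻¹) * (n * ∑ k ∈ Finset.range n, K (p k) (p (k + 1))) := by gcongr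
      have h2 : (1 + (n : ℝ)⁻¹) * (n * ∑ k ∈ Finset.range n, K (p k) (p (k + 1))) =
          (n + 1) * ∑ k ∈ Finset.range n, K (p k) (p (k + 1)) := by field_simp
      rw [Finset.sum_range_succ]
      push_cast
      linarith

end Path

variable {ℓ : ℕ}

/-- The nearest neighbour of `x` in the positive direction `i`, or `x` itself if there is none. -/
def up (x : Box ℓ) (i : Fin 3) : Box ℓ :=
  if h : (x i : ℕ) + 1 < ℓ then update x i ⟨x i + 1, h⟩ else x

lemma adj_up {x : Box ℓ} {i : Fin 3} (h : (x i : ℕ) + 1 < ℓ) : Adj x (up x i) := by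
  rw [up, dif_pos h, Adj, Finset.sum_eq_single i]
  · simp
  · intro j _ hj
    simp [hj]
  · simp

lemma up_eq_self {x : Box ℓ} {i : Fin 3} (h : ¬ (x i : ℕ) + 1 < ℓ) : up x i = x := dif_neg h

/-- The coordinates of `y` below `j` followed by those of `x` from `j` on. -/
def splice (j : ℕ) (x y : Box ℓ) : Box ℓ := fun i => if (i : ℕ) < j then y i else x i

lemma splice_zero (x y : Box ℓ) : splice 0 x y = x := by
  ext1 i; simp [splice]

lemma splice_three (x y : Box ℓ) : splice 3 x y = y := by
  ext1 i; simp [splice, i.2]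

lemma splice_succ (j : Fin 3) (x y : Box ℓ) :
    splice (j + 1) x y = update (splice j x y) j (splice j y x j) := by
  ext1 i
  by_cases h : i = j
  · subst h; simp [splice]
  · have : (i : ℕ) ≠ j := fun h' => h (Fin.ext h')
    have h2 : (i : ℕ) < j + 1 ↔ (i : ℕ) < j := by omega
    simp [splice, h, h2]

lemma splice_splice (j : ℕ) (x y : Box ℓ) : splice j (splice j x y) (splice j y x) = x := by
  ext1 i
  by_cases h : (i : ℕ) < j <;> simp [splice, h]

/-- Exchanging the first `j` coordinates of two points is an involution on pairs. -/
lemma sum_splice (j : ℕ) (F : Box ℓ → Box ℓ → ℝ) :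
    ∑ x, ∑ y, F (splice j x y) (splice j y x) = ∑ x, ∑ y, F x y := by
  have hinv : Involutive fun q : Box ℓ × Box ℓ => (splice j q.1 q.2, splice j q.2 q.1) := by
    rintro ⟨x, y⟩
    simp [splice_splice]
  have := Equiv.sum_comp hinv.toPerm (fun q : Box ℓ × Box ℓ => F q.1 q.2)
  rw [Fintype.sum_prod_type, Fintype.sum_prod_type] at this
  exact this

/-- Swapping `x i` with `k` is an involution on pairs `(x, k)`. -/
lemma sum_update (i : Fin 3) (F : Box ℓ → ℝ) :
    ∑ x : Box ℓ, ∑ k : Fin ℓ, F (update x i k) = ℓ * ∑ x, F x := by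
  have hinv : Involutive fun q : Box ℓ × Fin ℓ => (update q.1 i q.2, q.1 i) := by
    rintro ⟨x, k⟩
    simp
  have := Equiv.sum_comp hinv.toPerm (fun q : Box ℓ × Fin ℓ => F q.1)
  rw [Fintype.sum_prod_type, Fintype.sum_prod_type] at this
  refine this.trans ?_
  simp [Finset.mul_sum]

variable {K : Box ℓ → Box ℓ → ℝ}

lemma le_line_of_le (hK : IsSqDist K) (x : Box ℓ) (i : Fin 3) {s t : Fin ℓ} (hst : s ≤ t) :
    K (update x i s) (update x i t) ≤
      ℓ * ∑ k, K (update x i k) (up (update x i k) i) := by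
  obtain ⟨n, hn⟩ := Nat.exists_eq_add_of_le (Fin.le_def.1 hst)
  have ht := t.2
  set e : ℕ → ℝ := fun j => if h : j < ℓ then
    K (update x i ⟨j, h⟩) (up (update x i ⟨j, h⟩) i) else 0 with he
  have he0 : ∀ j, 0 ≤ e j := fun j => by
    simp only [he]
    split_ifs
    · exact hK.nonneg _ _
    · exact le_rfl
  -- The default is never reached for `k ≤ n`, as `s + n = t < ℓ`.
  set p : ℕ → Box ℓ := fun k => if h : (s : ℕ) + k < ℓ then update x i ⟨s + k, h⟩ else x with hp
  have hp0 : p 0 = update x i s := by simp [hp]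
  have hpn : p n = update x i t := by
    have h : (s : ℕ) + n < ℓ := by omega
    simp only [hp, dif_pos h]
    congr 1
    exact Fin.ext hn.symm
  have hsum : ∑ k, K (update x i k) (up (update x i k) i) = ∑ j ∈ Finset.range ℓ, e j := by
    rw [Finset.sum_range]
    refine Finset.sum_congr rfl fun k _ => ?_
    simp [he]
  have hpath := hK.le_path p n
  have hstep : ∑ k ∈ Finset.range n, K (p k) (p (k + 1)) = ∑ k ∈ Finset.range n, e (s + k) := by
    refine Finset.sum_congr rfl fun k hk => ?_
    have hk := Finset.mem_range.1 hk
    have h1 : (s : ℕ) + k < ℓ := by omega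
    have h2 : (s : ℕ) + (k + 1) < ℓ := by omega
    have h3 : (s : ℕ) + k + 1 < ℓ := by omega
    simp only [hp, he, dif_pos h1, dif_pos h2, up, update_self, dif_pos h3, update_idem]
    rfl
  have hle : ∑ k ∈ Finset.range n, e (s + k) ≤ ∑ j ∈ Finset.range ℓ, e j := by
    have h1 : ∑ k ∈ Finset.range n, e (s + k) = ∑ j ∈ Finset.Ico (s : ℕ) (s + n), e j := by
      rw [Finset.sum_Ico_eq_sum_range]
      simp
    rw [h1]
    refine Finset.sum_le_sum_of_subset_of_nonneg ?_ fun j _ _ => he0 j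
    intro j hj
    simp only [Finset.mem_Ico, Finset.mem_range] at hj ⊢
    omega
  rw [← hp0, ← hpn, hsum]
  refine hpath.trans ?_
  rw [hstep]
  have hnl : (n : ℝ) ≤ ℓ := by exact_mod_cast (by omega : n ≤ ℓ)
  have : 0 ≤ ∑ k ∈ Finset.range n, e (s + k) := Finset.sum_nonneg fun k _ => he0 _
  gcongr

lemma le_line (hK : IsSqDist K) (x : Box ℓ) (i : Fin 3) (t : Fin ℓ) :
    K x (update x i t) ≤ ℓ * ∑ k, K (update x i k) (up (update x i k) i) := by
  conv_lhs => rw [← update_eq_self i x]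
  rw [update_idem]
  rcases le_total (x i) t with h | h
  · exact hK.le_line_of_le x i h
  · rw [hK.comm]
    exact hK.le_line_of_le x i h

lemma sum_up_le (hK : IsSqDist K) (i : Fin 3) :
    ∑ x, K x (up x i) ≤ ∑ x, ∑ y, if Adj x y then K x y else 0 := by
  refine Finset.sum_le_sum fun x _ => ?_
  have hnn : ∀ y ∈ Finset.univ, 0 ≤ if Adj x y then K x y else 0 := fun y _ => by
    split_ifs
    · exact hK.nonneg _ _
    · exact le_rfl
  by_cases h : (x i : ℕ) + 1 < ℓ
  · refine le_trans ?_ (Finset.single_le_sum hnn (Finset.mem_univ (up x i)))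
    rw [if_pos (adj_up h)]
  · rw [up_eq_self h, hK.self]
    exact Finset.sum_nonneg hnn

/-- A Poincaré inequality on the box for squared pseudometrics. -/
theorem sum_le (hK : IsSqDist K) :
    ∑ x, ∑ y, K x y ≤ 9 * (ℓ : ℝ) ^ 5 * ∑ x, ∑ y, if Adj x y then K x y else 0 := by
  set A := ∑ x, ∑ y, if Adj x y then K x y else 0 with hA
  have hj : ∀ j : Fin 3, ∑ x, ∑ y, K (splice j x y) (splice (j + 1) x y) ≤ (ℓ : ℝ) ^ 5 * A := by
    intro j
    simp only [splice_succ]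
    -- After exchanging coordinates, the step starts at an arbitrary point and changes coordinate
    -- `j` only.
    rw [sum_splice j fun u w => K u (update u j (w j))]
    calc ∑ x, ∑ y : Box ℓ, K x (update x j (y j))
        ≤ ∑ x, ∑ _y : Box ℓ, ℓ * ∑ k, K (update x j k) (up (update x j k) j) := by
          gcongr with x _ y _
          exact hK.le_line x j (y j)
      -- The power is ℓ³ for the free point, ℓ for the path length, and ℓ because each edge is met
      -- from every point of its line.
      _ = (ℓ : ℝ) ^ 5 * ∑ x, K x (up x j) := by
          simp only [Finset.sum_const, Finset.card_univ, Fintype.card_fun, Fintype.card_fin,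
            nsmul_eq_mul, ← Finset.mul_sum]
          rw [sum_update j fun x => K x (up x j)]
          push_cast
          ring
      _ ≤ (ℓ : ℝ) ^ 5 * A := by
          gcongr
          exact hK.sum_up_le j
  calc ∑ x, ∑ y, K x y
      ≤ ∑ x, ∑ y, 3 * ∑ j : Fin 3, K (splice j x y) (splice (j + 1) x y) := by
        gcongr with x _ y _
        have h := hK.le_path (fun k => splice k x y) 3
        rw [Finset.sum_range] at h
        simpa only [splice_zero, splice_three, Nat.cast_ofNat] using h
    _ = 3 * ∑ j : Fin 3, ∑ x, ∑ y, K (splice j x y) (splice (j + 1) x y) := by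
        simp only [← Finset.mul_sum]
        congr 1
        rw [Finset.sum_comm]
        simp only [Finset.sum_comm (s := (Finset.univ : Finset (Fin 3)))]
        rw [Finset.sum_comm]
    _ ≤ 3 * ∑ _j : Fin 3, (ℓ : ℝ) ^ 5 * A := by
        gcongr with j _
        exact hj j
    _ = 9 * (ℓ : ℝ) ^ 5 * A := by
        simp
        ring

end IsSqDist

end Heisenberg

/-! ### The energy and the total spin as sums of pair energies -/

namespace Heisenberg

open Matrix Function

variable {d ℓ : ℕ}

/-- A state of the box as a function of the occupation numbers `σ x = S + m_x`, extended by zero. -/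
noncomputable def occ (ψ : Config d ℓ → ℂ) (n : Box ℓ → ℕ) : ℂ :=
  if h : ∀ x, n x < d + 1 then ψ fun x => ⟨n x, h x⟩ else 0

/-- The occupation numbers of a configuration. -/
def Config.val (σ : Config d ℓ) : Box ℓ → ℕ := fun x => σ x

lemma Config.val_injective : Injective (Config.val : Config d ℓ → Box ℓ → ℕ) := fun _ _ h =>
  funext fun x => Fin.ext (congrFun h x)

lemma occ_val (ψ : Config d ℓ → ℂ) (σ : Config d ℓ) : occ ψ σ.val = ψ σ := by
  have h : ∀ x, σ.val x < d + 1 := fun x => (σ x).2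
  rw [occ, dif_pos h]
  rfl

lemma supportedBelow_occ (ψ : Config d ℓ → ℂ) : SupportedBelow d (occ ψ) := by
  intro n hn x
  by_contra hx
  refine hn (dif_neg fun h => ?_)
  have := h x
  omega

lemma SupportedBelow.tsum_eq_sum {f : (Box ℓ → ℕ) → ℝ} (hf : SupportedBelow d f) :
    ∑' n, f n = ∑ σ : Config d ℓ, f σ.val := by
  rw [← Config.val_injective.tsum_eq (f := f), tsum_fintype]
  intro n hn
  exact ⟨fun x => ⟨n x, Nat.lt_succ_of_le (hf n hn x)⟩, rfl⟩

lemma siteLower_mulVec (x : Box ℓ) (ψ : Config d ℓ → ℂ) (σ : Config d ℓ) :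
    (siteLower d x *ᵥ ψ) σ =
      ((√((d : ℝ) - σ.val x) * √((σ.val x : ℝ) + 1) : ℝ) : ℂ) *
        occ ψ (σ.val + Pi.single x 1) := by
  rw [siteLower, atSite_mulVec]
  simp only [conjTranspose_apply, spinRaise_apply]
  have hle : ((σ x : ℕ) : ℝ) ≤ d := by exact_mod_cast Nat.lt_succ_iff.1 (σ x).2
  rw [← Real.sqrt_mul (sub_nonneg.2 hle : (0 : ℝ) ≤ (d : ℝ) - σ.val x)]
  by_cases hx : (σ x : ℕ) + 1 < d + 1
  · rw [Finset.sum_eq_single ⟨σ x + 1, hx⟩]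
    · have hval : σ.val + Pi.single x 1 = Config.val (update σ x ⟨σ x + 1, hx⟩) := by
        ext y
        by_cases hy : y = x
        · subst hy; simp [Config.val]
        · simp [Config.val, hy]
      rw [hval, occ_val, if_pos rfl, Complex.star_def, Complex.conj_ofReal]
      rfl
    · intro k _ hk
      have : ¬ (k : ℕ) = σ x + 1 := fun h => hk (Fin.ext h)
      simp [this]
    · simp
  · rw [Finset.sum_eq_zero, (supportedBelow_occ ψ).apply_add_eq_zero (x := x), mul_zero]
    · simp only [Config.val, Pi.single_eq_same]
      omega
    · intro k _
      have : ¬ (k : ℕ) = σ x + 1 := by have := k.2; omega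
      simp [this]

/-- The quadratic form of a pair interaction is half the pair energy. -/
lemma re_dotProduct_pair {x y : Box ℓ} (hxy : x ≠ y) (ψ : Config d ℓ → ℂ) :
    (star ψ ⬝ᵥ ((((spin d ^ 2 : ℝ) : ℂ) • (1 : Matrix (Config d ℓ) (Config d ℓ) ℂ) -
      spinDot d x y) *ᵥ ψ)).re = 1 / 2 * pairEnergy d x y (occ ψ) := by
  have hdiag : ((spin d ^ 2 : ℝ) : ℂ) • (1 : Matrix (Config d ℓ) (Config d ℓ) ℂ) -
      siteZ d x * siteZ d y = diagonal fun σ : Config d ℓ =>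
        ((1 / 2 * ((σ x : ℕ) * ((d : ℝ) - (σ y : ℕ)) + (σ y : ℕ) * ((d : ℝ) - (σ x : ℕ))) : ℝ) : ℂ) := by
    rw [siteZ_eq_diagonal, siteZ_eq_diagonal, diagonal_mul_diagonal, ← diagonal_one,
      ← diagonal_smul, diagonal_sub]
    congr 1
    ext σ
    simp [spin]
    ring
  have hcomm : siteLower d x * siteRaise d y = siteRaise d y * siteLower d x :=
    (commute_atSite hxy _ _).eq
  have hsplit : ((spin d ^ 2 : ℝ) : ℂ) • (1 : Matrix (Config d ℓ) (Config d ℓ) ℂ) -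
      spinDot d x y = (((spin d ^ 2 : ℝ) : ℂ) • (1 : Matrix (Config d ℓ) (Config d ℓ) ℂ) -
      siteZ d x * siteZ d y) - (1 / 2 : ℂ) • (siteRaise d x * siteLower d y +
        siteRaise d y * siteLower d x) := by
    rw [spinDot_eq, hcomm]
    module
  -- The hopping terms become inner products of lowered states, the cross term of
  -- `pairEnergy_expand`.
  have hinner : ∀ u v : Box ℓ, star ψ ⬝ᵥ ((siteRaise d u * siteLower d v) *ᵥ ψ) =
      star (siteLower d u *ᵥ ψ) ⬝ᵥ (siteLower d v *ᵥ ψ) := fun u v => by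
    rw [← mulVec_mulVec, star_mulVec, siteLower_conjTranspose, dotProduct_mulVec]
  have hsymm : (star (siteLower d y *ᵥ ψ) ⬝ᵥ (siteLower d x *ᵥ ψ)).re =
      (star (siteLower d x *ᵥ ψ) ⬝ᵥ (siteLower d y *ᵥ ψ)).re := by
    rw [← star_star (siteLower d x *ᵥ ψ), star_dotProduct_star, star_star, Complex.star_def,
      Complex.conj_re]
  rw [hsplit, sub_mulVec, hdiag, smul_mulVec, add_mulVec, dotProduct_sub, dotProduct_smul,
    dotProduct_add, hinner, hinner, Complex.sub_re, smul_eq_mul,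
    show (1 / 2 : ℂ) = ((1 / 2 : ℝ) : ℂ) by simp, Complex.re_ofReal_mul, Complex.add_re, hsymm,
    pairEnergy_expand (supportedBelow_occ ψ) hxy]
  have e1 : SupportedBelow d fun n : Box ℓ → ℕ =>
      ((n x : ℝ) * (d - n y) + n y * (d - n x)) * ‖occ ψ n‖ ^ 2 := by
    intro n hn w
    by_contra! hw
    exact hn (by simp only; rw [(supportedBelow_occ ψ).apply_eq_zero (x := w) hw]; simp)
  have e2 : SupportedBelow d fun n : Box ℓ → ℕ => (star
        (((√((d : ℝ) - n x) * √((n x : ℝ) + 1) : ℝ) : ℂ) * occ ψ (n + Pi.single x 1)) *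
        (((√((d : ℝ) - n y) * √((n y : ℝ) + 1) : ℝ) : ℂ) * occ ψ (n + Pi.single y 1))).re := by
    intro n hn w
    by_contra! hw
    refine hn ?_
    simp only
    rw [(supportedBelow_occ ψ).apply_add_eq_zero (m := Pi.single x 1) (x := w) (by omega)]
    simp
  rw [e1.tsum_eq_sum, e2.tsum_eq_sum]
  simp only [dotProduct, mulVec_diagonal, Pi.star_apply, siteLower_mulVec, occ_val, Complex.re_sum]
  rw [mul_sub, Finset.mul_sum]
  congr 1
  · refine Finset.sum_congr rfl fun σ _ => ?_
    rw [mul_left_comm, Complex.star_def, ← Complex.normSq_eq_conj_mul_self, Complex.re_ofReal_mul,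
      Complex.ofReal_re, Complex.normSq_eq_norm_sq]
    simp only [Config.val]
    ring
  · ring

lemma isSqDist_pairEnergy (hd : 0 < d) (ψ : Config d ℓ → ℂ) :
    IsSqDist fun x y : Box ℓ => pairEnergy d x y (occ ψ) where
  nonneg _ _ := pairEnergy_nonneg _ _ _ _
  self _ := pairEnergy_self _ _ _
  comm _ _ := pairEnergy_comm _ _ _ _
  triangle _ ht := pairEnergy_triangle hd (supportedBelow_occ ψ) ht

lemma re_dotProduct_hamiltonianMatrix (ψ : Config d ℓ → ℂ) :
    (star ψ ⬝ᵥ (hamiltonianMatrix d ℓ *ᵥ ψ)).re =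
      1 / 4 * ∑ x : Box ℓ, ∑ y : Box ℓ, if Adj x y then pairEnergy d x y (occ ψ) else 0 := by
  rw [hamiltonianMatrix, smul_mulVec, dotProduct_smul, smul_eq_mul,
    show (1 / 2 : ℂ) = ((1 / 2 : ℝ) : ℂ) by simp, Complex.re_ofReal_mul]
  simp only [sum_mulVec, dotProduct_sum, Complex.re_sum]
  simp only [Finset.mul_sum]
  refine Finset.sum_congr rfl fun x _ => Finset.sum_congr rfl fun y _ => ?_
  split_ifs with h
  · rw [re_dotProduct_pair h.ne]
    ring
  · simp

lemma re_dotProduct_self (ψ : Config d ℓ → ℂ) :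
    (star ψ ⬝ᵥ ψ).re = ∑ σ, ‖ψ σ‖ ^ 2 := by
  simp only [dotProduct, Pi.star_apply, Complex.re_sum]
  refine Finset.sum_congr rfl fun σ _ => ?_
  rw [Complex.star_def, ← Complex.normSq_eq_conj_mul_self, Complex.ofReal_re,
    Complex.normSq_eq_norm_sq]

/-- The sum of all pair energies is determined by the total spin. -/
lemma sum_pairEnergy (ψ : Config d ℓ → ℂ) :
    1 / 2 * ∑ x : Box ℓ, ∑ y : Box ℓ, pairEnergy d x y (occ ψ) =
      (spin d * (ℓ : ℝ) ^ 3) * (spin d * (ℓ : ℝ) ^ 3 + 1) * (star ψ ⬝ᵥ ψ).re -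
        (star ψ ⬝ᵥ (totalSpinSqMatrix d ℓ *ᵥ ψ)).re := by
  -- The extra S at coinciding sites makes the constants sum to S²ℓ⁶ + Sℓ³ = Sℓ³(Sℓ³ + 1).
  have hpair : ∀ x y : Box ℓ, (star ψ ⬝ᵥ (spinDot d x y *ᵥ ψ)).re =
      (spin d ^ 2 + if x = y then spin d else 0) * (star ψ ⬝ᵥ ψ).re -
        1 / 2 * pairEnergy d x y (occ ψ) := by
    intro x y
    split_ifs with h
    · subst h
      rw [spinDot_self, pairEnergy_self, smul_mulVec, one_mulVec, dotProduct_smul, smul_eq_mul,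
        Complex.re_ofReal_mul]
      ring
    · rw [← re_dotProduct_pair h, sub_mulVec, smul_mulVec, one_mulVec, dotProduct_sub,
        dotProduct_smul, smul_eq_mul, Complex.sub_re, Complex.re_ofReal_mul]
      ring
  rw [totalSpinSqMatrix_eq_sum_spinDot]
  simp only [sum_mulVec, dotProduct_sum, Complex.re_sum, hpair, Finset.sum_sub_distrib,
    ← Finset.sum_mul, ← Finset.mul_sum, Finset.sum_add_distrib]
  simp
  ring

lemma inner_eq_dotProduct (φ ψ : Space d ℓ) (M : Matrix (Config d ℓ) (Config d ℓ) ℂ) :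
    inner ℂ φ (toEuclideanLin M ψ) = star (φ.ofLp) ⬝ᵥ (M *ᵥ ψ.ofLp) := by
  rw [EuclideanSpace.inner_eq_star_dotProduct, dotProduct_comm]
  rfl

lemma norm_sq_eq_dotProduct (ψ : Space d ℓ) : ‖ψ‖ ^ 2 = (star (ψ.ofLp) ⬝ᵥ ψ.ofLp).re := by
  rw [re_dotProduct_self, EuclideanSpace.norm_sq_eq]

lemma hamiltonian_isSymmetric : (hamiltonian d ℓ).IsSymmetric :=
  isSymmetric_toEuclideanLin_iff.2 hamiltonianMatrix_conjTranspose

lemma inner_hamiltonian_re (ψ : Space d ℓ) :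
    (inner ℂ ψ (hamiltonian d ℓ ψ)).re =
      1 / 4 * ∑ x : Box ℓ, ∑ y : Box ℓ, if Adj x y then pairEnergy d x y (occ ψ.ofLp) else 0 := by
  rw [hamiltonian, inner_eq_dotProduct, re_dotProduct_hamiltonianMatrix]

lemma inner_hamiltonian_nonneg (ψ : Space d ℓ) : 0 ≤ (inner ℂ ψ (hamiltonian d ℓ ψ)).re := by
  rw [inner_hamiltonian_re]
  refine mul_nonneg (by norm_num) (Finset.sum_nonneg fun x _ => Finset.sum_nonneg fun y _ => ?_)
  split_ifs
  · exact pairEnergy_nonneg _ _ _ _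
  · exact le_rfl

/-- The bound on the excitation energy in the sector of total spin `s`. -/
lemma sector_bound (hd : 1 ≤ d) (hℓ : 1 ≤ ℓ) {s : ℝ} (hs : 0 ≤ s) {ψ : Space d ℓ}
    (hψ : ψ ∈ sector d ℓ s) :
    1 / 18 * spin d / (ℓ : ℝ) ^ 2 * (spin d * (ℓ : ℝ) ^ 3 - s) * ‖ψ‖ ^ 2 ≤
      (inner ℂ ψ (hamiltonian d ℓ ψ)).re := by
  have hS : 0 < spin d := by
    have : (0 : ℝ) < d := by exact_mod_cast hd
    rw [spin]
    positivity
  have hL : (0 : ℝ) < ℓ := by exact_mod_cast hℓ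
  -- For `s` above the maximal spin the claimed bound is nonpositive.
  rcases le_total (spin d * (ℓ : ℝ) ^ 3) s with hle | hle
  · refine le_trans ?_ (inner_hamiltonian_nonneg ψ)
    have h1 : 0 ≤ 1 / 18 * spin d / (ℓ : ℝ) ^ 2 := by positivity
    exact mul_nonpos_of_nonpos_of_nonneg
      (mul_nonpos_of_nonneg_of_nonpos h1 (by linarith)) (by positivity)
  · have hT : (star ψ.ofLp ⬝ᵥ (totalSpinSqMatrix d ℓ *ᵥ ψ.ofLp)).re = s * (s + 1) * ‖ψ‖ ^ 2 := by
      rw [← inner_eq_dotProduct, ← totalSpinSq, Module.End.mem_eigenspace_iff.1 hψ, inner_smul_right,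
        Complex.re_ofReal_mul, inner_self_eq_norm_sq_to_K]
      norm_cast
    have hsum := sum_pairEnergy ψ.ofLp
    rw [hT, ← norm_sq_eq_dotProduct] at hsum
    have hP := (isSqDist_pairEnergy hd ψ.ofLp).sum_le
    have hH := inner_hamiltonian_re ψ
    set A := ∑ x : Box ℓ, ∑ y : Box ℓ, if Adj x y then pairEnergy d x y (occ ψ.ofLp) else 0
    set B := ∑ x : Box ℓ, ∑ y : Box ℓ, pairEnergy d x y (occ ψ.ofLp)
    have hfac : 1 / 2 * B = (spin d * (ℓ : ℝ) ^ 3 - s) * (spin d * (ℓ : ℝ) ^ 3 + s + 1) * ‖ψ‖ ^ 2 := by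
      rw [hsum]; ring
    have hlow : (spin d * (ℓ : ℝ) ^ 3 - s) * (spin d * (ℓ : ℝ) ^ 3) * ‖ψ‖ ^ 2 ≤ 1 / 2 * B := by
      rw [hfac]
      have := sub_nonneg.2 hle
      gcongr
      linarith
    rw [hH]
    have h5 : (0 : ℝ) < (ℓ : ℝ) ^ 5 := by positivity
    refine le_of_mul_le_mul_left ?_ h5
    have e : (ℓ : ℝ) ^ 5 * (1 / 18 * spin d / (ℓ : ℝ) ^ 2 * (spin d * (ℓ : ℝ) ^ 3 - s) * ‖ψ‖ ^ 2) =
        1 / 18 * ((spin d * (ℓ : ℝ) ^ 3 - s) * (spin d * (ℓ : ℝ) ^ 3) * ‖ψ‖ ^ 2) := by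
      field_simp
    rw [e]
    linarith

lemma hamiltonian_mem_sector {s : ℝ} {ψ : Space d ℓ} (hψ : ψ ∈ sector d ℓ s) :
    hamiltonian d ℓ ψ ∈ sector d ℓ s := by
  rw [sector, Module.End.mem_eigenspace_iff] at hψ ⊢
  have hc : totalSpinSq d ℓ (hamiltonian d ℓ ψ) = hamiltonian d ℓ (totalSpinSq d ℓ ψ) := by
    refine (WithLp.equiv 2 _).injective ?_
    change totalSpinSqMatrix d ℓ *ᵥ (hamiltonianMatrix d ℓ *ᵥ ψ.ofLp) =
      hamiltonianMatrix d ℓ *ᵥ (totalSpinSqMatrix d ℓ *ᵥ ψ.ofLp)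
    rw [mulVec_mulVec, mulVec_mulVec, commute_hamiltonianMatrix_totalSpinSqMatrix.eq]
  rw [hc, hψ, map_smul]

end Heisenberg

/-! ### The ground state energy -/

namespace Heisenberg

open Matrix Function

variable {d ℓ : ℕ}

/-- A zero of a nonnegative form is a minimiser, so perturbing it in the direction Hψ cannot lower
the form. -/
lemma hamiltonian_eq_zero_of_inner {ψ : Space d ℓ}
    (h : (inner ℂ ψ (hamiltonian d ℓ ψ)).re = 0) : hamiltonian d ℓ ψ = 0 := by
  set φ := hamiltonian d ℓ ψ with hφ
  set b := (inner ℂ φ (hamiltonian d ℓ φ)).re with hb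
  have hsym : inner ℂ ψ (hamiltonian d ℓ φ) = inner ℂ φ φ := (hamiltonian_isSymmetric ψ φ).symm
  have hre : (inner ℂ φ φ).re = ‖φ‖ ^ 2 := by
    rw [inner_self_eq_norm_sq_to_K]; norm_cast
  have key : ∀ t : ℝ, 0 ≤ 2 * t * ‖φ‖ ^ 2 + t ^ 2 * b := by
    intro t
    have h0 := inner_hamiltonian_nonneg (ψ + (t : ℂ) • φ)
    rw [map_add, map_smul, inner_add_left, inner_add_right, inner_add_right, inner_smul_left,
      inner_smul_left, inner_smul_right, inner_smul_right, hsym, ← hφ, Complex.conj_ofReal] at h0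
    simp only [Complex.add_re, Complex.re_ofReal_mul, h, hre] at h0
    rw [← hb] at h0
    nlinarith
  have hb0 : 0 ≤ b := inner_hamiltonian_nonneg φ
  -- A small negative `t` suffices; `b + 1` replaces `b`, which may vanish.
  have h1 := key (-‖φ‖ ^ 2 / (b + 1))
  have hb1 : 0 < b + 1 := by linarith
  have h2 : 2 * (-‖φ‖ ^ 2 / (b + 1)) * ‖φ‖ ^ 2 + (-‖φ‖ ^ 2 / (b + 1)) ^ 2 * b =
      -(‖φ‖ ^ 2 / (b + 1)) ^ 2 * (b + 2) := by field_simp; ring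
  rw [h2] at h1
  have h3 : (‖φ‖ ^ 2 / (b + 1)) ^ 2 = 0 := by
    by_contra hne
    have : 0 < (‖φ‖ ^ 2 / (b + 1)) ^ 2 := lt_of_le_of_ne (sq_nonneg _) (Ne.symm hne)
    nlinarith
  rw [sq_eq_zero_iff, div_eq_zero_iff, or_iff_left hb1.ne', sq_eq_zero_iff, norm_eq_zero] at h3
  exact h3

lemma energies_nonneg {E : ℝ} (hE : E ∈ energies d ℓ) : 0 ≤ E := by
  obtain ⟨ψ, hψ⟩ := Module.End.HasEigenvalue.exists_hasEigenvector hE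
  have h := inner_hamiltonian_nonneg ψ
  rw [hψ.apply_eq_smul, inner_smul_right, Complex.re_ofReal_mul, inner_self_eq_norm_sq_to_K] at h
  norm_cast at h
  have h2 : 0 < ‖ψ‖ ^ 2 := by
    have := norm_pos_iff.2 hψ.2
    positivity
  exact nonneg_of_mul_nonneg_left h h2

/-- The configuration in which every spin points up. -/
def allUp (d ℓ : ℕ) : Config d ℓ := fun _ => Fin.last d

/-- The configuration in which the spin at `x` is lowered by one and all others point up. -/
def magnon (d : ℕ) {ℓ : ℕ} (x : Box ℓ) : Config d ℓ :=
  fun w => if w = x then ⟨d - 1, by omega⟩ else Fin.last d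

lemma exists_config_of_occ_ne_zero {ψ : Config d ℓ → ℂ} {n : Box ℓ → ℕ} (h : occ ψ n ≠ 0) :
    ∃ σ : Config d ℓ, σ.val = n ∧ ψ σ ≠ 0 := by
  have hn : ∀ x, n x < d + 1 := by
    by_contra hc
    exact h (dif_neg hc)
  refine ⟨fun x => ⟨n x, hn x⟩, rfl, ?_⟩
  rwa [occ, dif_pos hn] at h

/-- The singlet annihilator needs a b-boson, and the fully polarised state has none: a nonzero
amplitude forces √(d - n v) = 0. -/
lemma inner_hamiltonian_of_forall_ne_allUp {ψ : Space d ℓ}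
    (h : ∀ σ, σ ≠ allUp d ℓ → ψ.ofLp σ = 0) : (inner ℂ ψ (hamiltonian d ℓ ψ)).re = 0 := by
  have hocc : ∀ n, occ ψ.ofLp n ≠ 0 → ∀ x, n x = d := by
    intro n hn x
    obtain ⟨σ, rfl, hσ⟩ := exists_config_of_occ_ne_zero hn
    by_cases hσ' : σ = allUp d ℓ
    · subst hσ'; rfl
    · exact absurd (h σ hσ') hσ
  rw [inner_hamiltonian_re, Finset.sum_eq_zero, mul_zero]
  intro x _
  refine Finset.sum_eq_zero fun y _ => ?_
  split_ifs with hadj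
  · have hxy := hadj.ne
    have hz : ∀ u v : Box ℓ, u ≠ v → ∀ n : Box ℓ → ℕ,
        √((d : ℝ) - n v) = 0 ∨ occ ψ.ofLp (n + Pi.single u 1) = 0 := by
      intro u v huv n
      by_contra! hc
      have hv := hocc _ hc.2 v
      rw [Pi.add_apply, Pi.single_eq_of_ne huv.symm, add_zero] at hv
      exact hc.1 (by rw [hv]; simp)
    have : ∀ n, pairLower d x y (occ ψ.ofLp) n = 0 := by
      intro n
      rw [pairLower]
      rcases hz x y hxy n with h1 | h1 <;> rcases hz y x hxy.symm n with h2 | h2 <;> simp [h1, h2]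
    simp [pairEnergy, this]
  · rfl

lemma zero_mem_energies : (0 : ℝ) ∈ energies d ℓ := by
  refine Module.End.hasEigenvalue_of_hasEigenvector
    (x := EuclideanSpace.single (allUp d ℓ) (1 : ℂ)) ⟨?_, ?_⟩
  · rw [Module.End.mem_eigenspace_iff, Complex.ofReal_zero, zero_smul]
    refine hamiltonian_eq_zero_of_inner (inner_hamiltonian_of_forall_ne_allUp fun σ hσ => ?_)
    simp [hσ]
  · simp

/-! ### Highest weight vectors and the lower bound on the gap -/

section HighestWeight

/-- The number of units by which the third spin component exceeds its minimum. -/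
def weight (σ : Config d ℓ) : ℕ := ∑ x, (σ x : ℕ)

lemma weight_le (σ : Config d ℓ) : weight σ ≤ d * ℓ ^ 3 := by
  have : weight σ ≤ ∑ _x : Box ℓ, d := Finset.sum_le_sum fun x _ => Nat.lt_succ_iff.1 (σ x).2
  simpa [mul_comm] using this

lemma eq_allUp_of_weight {σ : Config d ℓ} (h : weight σ = d * ℓ ^ 3) : σ = allUp d ℓ := by
  by_contra hne
  obtain ⟨x, hx⟩ := Function.ne_iff.1 hne
  have hlt : weight σ < ∑ _x : Box ℓ, d := by
    refine Finset.sum_lt_sum (fun x _ => Nat.lt_succ_iff.1 (σ x).2) ⟨x, Finset.mem_univ x, ?_⟩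
    refine lt_of_le_of_ne (Nat.lt_succ_iff.1 (σ x).2) fun hd => hx (Fin.ext hd)
  have : ∑ _x : Box ℓ, d = d * ℓ ^ 3 := by simp [mul_comm]
  omega

lemma totalZ_mulVec (ψ : Config d ℓ → ℂ) (σ : Config d ℓ) :
    (totalZ d ℓ *ᵥ ψ) σ = (((weight σ : ℝ) - spin d * (ℓ : ℝ) ^ 3 : ℝ) : ℂ) * ψ σ := by
  rw [totalZ_eq_diagonal, mulVec_diagonal]
  rfl

lemma hamiltonianMatrix_apply_of_weight_ne {σ τ : Config d ℓ} (h : weight σ ≠ weight τ) :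
    hamiltonianMatrix d ℓ σ τ = 0 := by
  have hc := congrFun (congrFun (commute_hamiltonianMatrix_totalZ (d := d) (ℓ := ℓ)).eq σ) τ
  rw [totalZ_eq_diagonal, mul_diagonal, diagonal_mul] at hc
  have hne : ((weight τ : ℂ) - weight σ) ≠ 0 := by
    rw [sub_ne_zero]
    exact_mod_cast h.symm
  have : hamiltonianMatrix d ℓ σ τ * ((weight τ : ℂ) - weight σ) = 0 := by
    simp only [weight]
    push_cast at hc ⊢
    linear_combination hc
  exact (mul_eq_zero.1 this).resolve_right hne

/-- `ψ` is a joint eigenvector of the Hamiltonian and of the third component of the total spin. -/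
def IsWeightVector (g : ℂ) (w : ℕ) (ψ : Config d ℓ → ℂ) : Prop :=
  ψ ≠ 0 ∧ hamiltonianMatrix d ℓ *ᵥ ψ = g • ψ ∧
    totalZ d ℓ *ᵥ ψ = (((w : ℝ) - spin d * (ℓ : ℝ) ^ 3 : ℝ) : ℂ) • ψ

lemma IsWeightVector.weight_eq {g : ℂ} {w : ℕ} {ψ : Config d ℓ → ℂ} (h : IsWeightVector g w ψ)
    {σ : Config d ℓ} (hσ : ψ σ ≠ 0) : weight σ = w := by
  have h2 := congrFun h.2.2 σ
  rw [totalZ_mulVec, Pi.smul_apply, smul_eq_mul] at h2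
  have h3 := Complex.ofReal_injective (mul_right_cancel₀ hσ h2)
  exact_mod_cast sub_left_injective h3

/-- The Hamiltonian is block diagonal in the weight, so an eigenvector may be cut down to one weight
in its support. -/
lemma exists_isWeightVector {g : ℂ} {ψ : Config d ℓ → ℂ} (h0 : ψ ≠ 0)
    (h : hamiltonianMatrix d ℓ *ᵥ ψ = g • ψ) :
    ∃ w, ∃ φ : Config d ℓ → ℂ, IsWeightVector g w φ := by
  obtain ⟨σ₀, hσ₀⟩ := Function.ne_iff.1 h0
  refine ⟨weight σ₀, fun σ => if weight σ = weight σ₀ then ψ σ else 0, ?_, ?_, ?_⟩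
  · intro hc
    have := congrFun hc σ₀
    simp only [if_true] at this
    exact hσ₀ this
  · ext σ
    have hσ := congrFun h σ
    simp only [mulVec, dotProduct, Pi.smul_apply, smul_eq_mul] at hσ ⊢
    by_cases hw : weight σ = weight σ₀
    · rw [if_pos hw, ← hσ]
      refine Finset.sum_congr rfl fun τ _ => ?_
      by_cases hτ : weight τ = weight σ₀
      · rw [if_pos hτ]
      · rw [hamiltonianMatrix_apply_of_weight_ne (by rw [hw]; exact Ne.symm hτ), zero_mul, zero_mul]
    · rw [if_neg hw, mul_zero]
      refine Finset.sum_eq_zero fun τ _ => ?_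
      by_cases hτ : weight τ = weight σ₀
      · rw [hamiltonianMatrix_apply_of_weight_ne (by rw [hτ]; exact hw), zero_mul]
      · rw [if_neg hτ, mul_zero]
  · ext σ
    rw [totalZ_mulVec, Pi.smul_apply, smul_eq_mul]
    by_cases hw : weight σ = weight σ₀
    · rw [hw]
    · rw [if_neg hw, mul_zero, mul_zero]

lemma IsWeightVector.totalRaise {g : ℂ} {w : ℕ} {ψ : Config d ℓ → ℂ} (h : IsWeightVector g w ψ)
    (hne : totalRaise d ℓ *ᵥ ψ ≠ 0) : IsWeightVector g (w + 1) (totalRaise d ℓ *ᵥ ψ) := by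
  refine ⟨hne, ?_, ?_⟩
  · rw [mulVec_mulVec, commute_hamiltonianMatrix_totalRaise.eq, ← mulVec_mulVec, h.2.1, mulVec_smul]
  · rw [mulVec_mulVec, sub_eq_iff_eq_add.1 totalZ_totalRaise_commutator, add_mulVec,
      ← mulVec_mulVec, h.2.2, mulVec_smul]
    push_cast
    module

/-- Each raising adds one to the weight, which never exceeds `d * ℓ ^ 3`, so raising must end in
zero. -/
lemma exists_highest_weight {g : ℂ} {ψ : Config d ℓ → ℂ} (h0 : ψ ≠ 0)
    (h : hamiltonianMatrix d ℓ *ᵥ ψ = g • ψ) :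
    ∃ w, ∃ φ : Config d ℓ → ℂ, IsWeightVector g w φ ∧ totalRaise d ℓ *ᵥ φ = 0 := by
  by_contra! hc
  obtain ⟨w, hw⟩ := exists_isWeightVector h0 h
  have hall : ∀ k, ∃ φ : Config d ℓ → ℂ, IsWeightVector g (w + k) φ := by
    intro k
    induction k with
    | zero => exact hw
    | succ k ih =>
      obtain ⟨φ, hφ⟩ := ih
      exact ⟨_, hφ.totalRaise (hc _ _ hφ)⟩
  obtain ⟨φ, hφ⟩ := hall (d * ℓ ^ 3 + 1)
  obtain ⟨σ, hσ⟩ := Function.ne_iff.1 hφ.1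
  have h1 := hφ.weight_eq hσ
  have h2 := weight_le σ
  omega

lemma totalSpinSqMatrix_mulVec_of_highest {c : ℂ} {ψ : Config d ℓ → ℂ}
    (hz : totalZ d ℓ *ᵥ ψ = c • ψ) (hr : totalRaise d ℓ *ᵥ ψ = 0) :
    totalSpinSqMatrix d ℓ *ᵥ ψ = (c * (c + 1)) • ψ := by
  rw [totalSpinSqMatrix_eq, add_mulVec, add_mulVec, ← mulVec_mulVec, ← mulVec_mulVec, hr, hz,
    mulVec_zero, mulVec_smul, hz]
  module

/-- On such a vector [S⁺, S⁻] = 2S³ gives ‖S⁻ψ‖² = 2m‖ψ‖². -/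
lemma highest_weight_nonneg {m : ℝ} {ψ : Config d ℓ → ℂ} (h0 : ψ ≠ 0)
    (hz : totalZ d ℓ *ᵥ ψ = (m : ℂ) • ψ) (hr : totalRaise d ℓ *ᵥ ψ = 0) : 0 ≤ m := by
  have h1 : star (totalLower d ℓ *ᵥ ψ) ⬝ᵥ (totalLower d ℓ *ᵥ ψ) =
      ((2 * m : ℝ) : ℂ) * (star ψ ⬝ᵥ ψ) := by
    rw [star_mulVec, totalLower_conjTranspose, ← dotProduct_mulVec, mulVec_mulVec,
      sub_eq_iff_eq_add.1 totalRaise_commutator, add_mulVec, add_mulVec, ← mulVec_mulVec, hr, hz,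
      mulVec_zero, add_zero, dotProduct_add, dotProduct_smul, smul_eq_mul]
    push_cast
    ring
  have h2 := congrArg Complex.re h1
  rw [Complex.re_ofReal_mul, re_dotProduct_self, re_dotProduct_self] at h2
  have h3 : 0 ≤ ∑ σ, ‖(totalLower d ℓ *ᵥ ψ) σ‖ ^ 2 := by positivity
  have h4 : 0 < ∑ σ, ‖ψ σ‖ ^ 2 := by
    obtain ⟨σ, hσ⟩ := Function.ne_iff.1 h0
    refine Finset.sum_pos' (fun _ _ => by positivity) ⟨σ, Finset.mem_univ _, ?_⟩
    have := norm_pos_iff.2 hσ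
    positivity
  rw [h2] at h3
  have := nonneg_of_mul_nonneg_left h3 h4
  linarith

/-- Every positive energy is at least of order `S / ℓ ^ 2`. -/
lemma gap_lower_bound (hd : 1 ≤ d) (hℓ : 1 ≤ ℓ) {E : ℝ} (hE : E ∈ energies d ℓ) (hpos : 0 < E) :
    1 / 18 * spin d / (ℓ : ℝ) ^ 2 ≤ E := by
  obtain ⟨ψ₀, hψ₀⟩ := Module.End.HasEigenvalue.exists_hasEigenvector hE
  have hne : ψ₀.ofLp ≠ 0 := fun h => hψ₀.2 (by ext σ; exact congrFun h σ)
  have heig : hamiltonianMatrix d ℓ *ᵥ ψ₀.ofLp = (E : ℂ) • ψ₀.ofLp :=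
    congrArg WithLp.ofLp hψ₀.apply_eq_smul
  obtain ⟨w, φ, hφ, hr⟩ := exists_highest_weight hne heig
  set m : ℝ := (w : ℝ) - spin d * (ℓ : ℝ) ^ 3 with hm
  have hm0 : 0 ≤ m := highest_weight_nonneg hφ.1 hφ.2.2 hr
  set Φ : Space d ℓ := WithLp.toLp 2 φ with hΦ
  have hΦ0 : Φ ≠ 0 := fun h => hφ.1 (congrArg WithLp.ofLp h)
  have hΦpos : 0 < ‖Φ‖ ^ 2 := by
    have := norm_pos_iff.2 hΦ0
    positivity
  have hsec : Φ ∈ sector d ℓ m := by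
    rw [sector, Module.End.mem_eigenspace_iff]
    refine (WithLp.equiv 2 _).injective ?_
    have := totalSpinSqMatrix_mulVec_of_highest hφ.2.2 hr
    push_cast
    exact this
  have hHΦ : hamiltonian d ℓ Φ = (E : ℂ) • Φ := (WithLp.equiv 2 _).injective hφ.2.1
  have hform : (inner ℂ Φ (hamiltonian d ℓ Φ)).re = E * ‖Φ‖ ^ 2 := by
    rw [hHΦ, inner_smul_right, Complex.re_ofReal_mul, inner_self_eq_norm_sq_to_K]
    norm_cast
  obtain ⟨σ, hσ⟩ := Function.ne_iff.1 hφ.1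
  have hwle : w ≤ d * ℓ ^ 3 := hφ.weight_eq hσ ▸ weight_le σ
  -- At maximal weight only `allUp` remains, and its energy is zero.
  have hwne : w ≠ d * ℓ ^ 3 := by
    intro hw
    have := inner_hamiltonian_of_forall_ne_allUp (ψ := Φ) fun τ hτ => by
      by_contra hτ0
      exact hτ (eq_allUp_of_weight ((hφ.weight_eq hτ0).trans hw))
    rw [hform] at this
    exact absurd this (by positivity)
  -- The difference is the positive integer `d * ℓ ^ 3 - w`.
  have hgap : 1 ≤ spin d * (ℓ : ℝ) ^ 3 - m := by
    have : ((w + 1 : ℕ) : ℝ) ≤ ((d * ℓ ^ 3 : ℕ) : ℝ) := by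
      exact_mod_cast Nat.lt_of_le_of_ne hwle hwne
    push_cast at this
    rw [hm, spin]
    linarith
  have hb := sector_bound hd hℓ hm0 hsec
  rw [hform] at hb
  have hb' := le_of_mul_le_mul_right hb hΦpos
  have hS : 0 ≤ 1 / 18 * spin d / (ℓ : ℝ) ^ 2 := by
    rw [spin]
    positivity
  nlinarith

end HighestWeight

end Heisenberg

namespace Heisenberg

open Matrix Function

variable {d ℓ : ℕ}

/-! ### The variational principle -/

section Variational

variable {E : Type*} [NormedAddCommGroup E] [InnerProductSpace ℂ E] [FiniteDimensional ℂ E]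

/-- The variational principle for the smallest positive eigenvalue of a positive operator. -/
lemma exists_pos_eigenvalue_le {T : E →ₗ[ℂ] E} (hT : T.IsSymmetric)
    (hnn : ∀ μ : ℝ, Module.End.HasEigenvalue T (μ : ℂ) → 0 ≤ μ) {φ : E} (hφ : φ ≠ 0)
    (hker : ∀ v, T v = 0 → inner ℂ v φ = 0) {c : ℝ}
    (hc : (inner ℂ φ (T φ)).re ≤ c * ‖φ‖ ^ 2) :
    ∃ μ : ℝ, Module.End.HasEigenvalue T (μ : ℂ) ∧ 0 < μ ∧ μ ≤ c := by
  by_contra! hcon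
  set b := hT.eigenvectorBasis rfl
  set ev := hT.eigenvalues rfl
  have happ : ∀ i, T (b i) = (ev i : ℂ) • b i := fun i => hT.apply_eigenvectorBasis rfl i
  have hev : ∀ i, Module.End.HasEigenvalue T (ev i : ℂ) :=
    fun i => hT.hasEigenvalue_eigenvalues rfl i
  have h1 : inner ℂ φ (T φ) = ∑ i, ((ev i * ‖inner ℂ (b i) φ‖ ^ 2 : ℝ) : ℂ) := by
    rw [← b.sum_inner_mul_inner]
    refine Finset.sum_congr rfl fun i _ => ?_
    rw [← hT, happ, inner_smul_left, Complex.conj_ofReal, ← inner_conj_symm φ (b i),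
      mul_left_comm, RCLike.conj_mul]
    push_cast
    rfl
  have h2 : ‖φ‖ ^ 2 = ∑ i, ‖inner ℂ (b i) φ‖ ^ 2 := (b.sum_sq_norm_inner_right φ).symm
  rw [h1, Complex.re_sum, h2, Finset.mul_sum] at hc
  simp only [Complex.ofReal_re] at hc
  -- An eigenvector overlapping `φ` is not in the kernel, so its eigenvalue is positive and, by
  -- contradiction hypothesis, above `c`.
  have hterm : ∀ i, inner ℂ (b i) φ ≠ 0 → c < ev i := by
    intro i hi
    refine hcon _ (hev i) (lt_of_le_of_ne (hnn _ (hev i)) fun h0 => hi (hker _ ?_))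
    rw [happ, ← h0, Complex.ofReal_zero, zero_smul]
  have hex : ∃ i, inner ℂ (b i) φ ≠ 0 := by
    by_contra! hall
    have : ‖φ‖ ^ 2 = 0 := by
      rw [h2]
      exact Finset.sum_eq_zero fun i _ => by simp [hall i]
    exact hφ (by simpa using this)
  obtain ⟨i₀, hi₀⟩ := hex
  refine absurd hc (not_le.2 (Finset.sum_lt_sum (fun i _ => ?_) ⟨i₀, Finset.mem_univ _, ?_⟩))
  · by_cases hi : inner ℂ (b i) φ = 0
    · simp [hi]
    · have := hterm i hi
      gcongr
  · have h3 := hterm i₀ hi₀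
    have h4 := norm_pos_iff.2 hi₀
    gcongr

end Variational

/-! ### One-magnon states -/

section Magnon

lemma magnon_self_val (x : Box ℓ) : (magnon d x).val x = d - 1 := by
  simp [magnon, Config.val]

lemma magnon_val_of_ne {x y : Box ℓ} (h : y ≠ x) : (magnon d x).val y = d := by
  simp [magnon, Config.val, h]

lemma magnon_injective (hd : 0 < d) : Injective (magnon d : Box ℓ → Config d ℓ) := by
  intro x y h
  by_contra hxy
  have h1 := magnon_self_val (d := d) x
  rw [h, magnon_val_of_ne hxy] at h1
  omega

/-- The occupation numbers with one particle removed from the filled box at `x` and at `y`. -/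
def pairHole (d : ℕ) {ℓ : ℕ} (x y : Box ℓ) : Box ℓ → ℕ :=
  fun w => if w = x ∨ w = y then d - 1 else d

lemma pairHole_comm (x y : Box ℓ) : pairHole d x y = pairHole d y x := by
  ext w
  simp [pairHole, or_comm]

lemma pairHole_add_single (hd : 0 < d) {x y : Box ℓ} (hxy : x ≠ y) :
    pairHole d x y + Pi.single x 1 = (magnon d y).val := by
  ext w
  by_cases hwx : w = x
  · subst hwx
    rw [magnon_val_of_ne hxy]
    simp [pairHole]
    omega
  · by_cases hwy : w = y
    · subst hwy
      rw [magnon_self_val]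
      simp [pairHole, hwx]
    · rw [magnon_val_of_ne hwy]
      simp [pairHole, hwx, hwy]

/-- This one component of A_xy ψ detects the difference of two magnon amplitudes. -/
lemma pairLower_pairHole (hd : 0 < d) {x y : Box ℓ} (hxy : x ≠ y) (ψ : Config d ℓ → ℂ) :
    pairLower d x y (occ ψ) (pairHole d x y) =
      (√(d : ℝ) : ℂ) * (ψ (magnon d y) - ψ (magnon d x)) := by
  have h1 : ((d - 1 : ℕ) : ℝ) = (d : ℝ) - 1 := by push_cast [Nat.one_le_iff_ne_zero.2 hd.ne']; ring
  have h2 : pairHole d x y + Pi.single y 1 = (magnon d x).val := by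
    rw [pairHole_comm, pairHole_add_single hd hxy.symm]
  rw [pairLower, pairHole_add_single hd hxy, h2, occ_val, occ_val]
  simp [pairHole, h1]
  ring

/-- The superposition with amplitudes `f` of the states with a single lowered spin. -/
noncomputable def magnonState (d : ℕ) {ℓ : ℕ} (f : Box ℓ → ℝ) : Space d ℓ :=
  ∑ x, EuclideanSpace.single (magnon d x) ((f x : ℝ) : ℂ)

lemma magnonState_magnon (hd : 0 < d) (f : Box ℓ → ℝ) (x : Box ℓ) :
    (magnonState d f).ofLp (magnon d x) = f x := by
  simp [magnonState, Pi.single_apply, (magnon_injective hd).eq_iff]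

lemma magnonState_eq_zero (f : Box ℓ → ℝ) {σ : Config d ℓ} (h : ∀ x, σ ≠ magnon d x) :
    (magnonState d f).ofLp σ = 0 := by
  simp [magnonState, h]

lemma inner_magnonState (v : Space d ℓ) (f : Box ℓ → ℝ) :
    inner ℂ v (magnonState d f) = ∑ x, (f x : ℂ) * star (v.ofLp (magnon d x)) := by
  simp [magnonState, EuclideanSpace.inner_single_right]

lemma norm_sq_magnonState (hd : 0 < d) (f : Box ℓ → ℝ) :
    ‖magnonState d f‖ ^ 2 = ∑ x, f x ^ 2 := by
  have h := inner_magnonState (magnonState d f) f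
  rw [inner_self_eq_norm_sq_to_K] at h
  simp only [magnonState_magnon hd, Complex.star_def, Complex.conj_ofReal, ← sq] at h
  refine Complex.ofReal_injective ?_
  push_cast
  exact h

/-- A nonzero root means that `y` is not full, so the single lowered spin sits at `y`. -/
lemma occ_magnonState_ne_zero {f : Box ℓ → ℝ} {x y : Box ℓ} (hd : 0 < d) (hxy : x ≠ y)
    {n : Box ℓ → ℕ} (hn : √((d : ℝ) - n y) ≠ 0)
    (h : occ (magnonState d f).ofLp (n + Pi.single x 1) ≠ 0) : n = pairHole d x y := by
  obtain ⟨σ, hσ, hne⟩ := exists_config_of_occ_ne_zero h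
  have hz : ∃ z, σ = magnon d z := by
    by_contra! hc
    exact hne (magnonState_eq_zero f hc)
  obtain ⟨z, rfl⟩ := hz
  have hzy : y = z := by
    by_contra hyz
    have hy := congrFun hσ y
    rw [magnon_val_of_ne hyz, Pi.add_apply, Pi.single_eq_of_ne hxy.symm, add_zero] at hy
    exact hn (by rw [← hy]; simp)
  subst hzy
  rw [← pairHole_add_single hd hxy] at hσ
  exact (add_right_cancel hσ).symm

lemma pairEnergy_magnonState (hd : 0 < d) (f : Box ℓ → ℝ) {x y : Box ℓ} (hxy : x ≠ y) :
    pairEnergy d x y (occ (magnonState d f).ofLp) = d * (f y - f x) ^ 2 := by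
  rw [pairEnergy, tsum_eq_single (pairHole d x y)]
  · rw [pairLower_pairHole hd hxy, magnonState_magnon hd, magnonState_magnon hd,
      norm_sqrt_mul_sq (Nat.cast_nonneg d), ← Complex.ofReal_sub, Complex.norm_real,
      Real.norm_eq_abs, sq_abs]
  · intro n hn
    have h1 : √((d : ℝ) - n y) = 0 ∨ occ (magnonState d f).ofLp (n + Pi.single x 1) = 0 := by
      by_contra! hc
      exact hn (occ_magnonState_ne_zero hd hxy hc.1 hc.2)
    have h2 : √((d : ℝ) - n x) = 0 ∨ occ (magnonState d f).ofLp (n + Pi.single y 1) = 0 := by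
      by_contra! hc
      rw [pairHole_comm] at hn
      exact hn (occ_magnonState_ne_zero hd hxy.symm hc.1 hc.2)
    rw [pairLower]
    rcases h1 with h1 | h1 <;> rcases h2 with h2 | h2 <;> simp [h1, h2]

/-- Ground states have constant one-magnon amplitudes. -/
lemma magnon_amplitude_eq (hd : 0 < d) {v : Space d ℓ} (hv : hamiltonian d ℓ v = 0)
    (x y : Box ℓ) : v.ofLp (magnon d x) = v.ofLp (magnon d y) := by
  by_cases hxy : x = y
  · rw [hxy]
  have hK := isSqDist_pairEnergy hd v.ofLp
  have h0 := inner_hamiltonian_re v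
  rw [hv, inner_zero_right, Complex.zero_re] at h0
  have hsum := hK.sum_le
  rw [show (∑ x : Box ℓ, ∑ y : Box ℓ, if Adj x y then pairEnergy d x y (occ v.ofLp) else 0) = 0 by
    linarith, mul_zero] at hsum
  have hle : pairEnergy d x y (occ v.ofLp) ≤
      ∑ x : Box ℓ, ∑ y : Box ℓ, pairEnergy d x y (occ v.ofLp) :=
    (Finset.single_le_sum (fun y _ => hK.nonneg x y) (Finset.mem_univ y)).trans
      (Finset.single_le_sum (f := fun x => ∑ y : Box ℓ, pairEnergy d x y (occ v.ofLp))
        (fun x _ => Finset.sum_nonneg fun y _ => hK.nonneg x y) (Finset.mem_univ x))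
  have hterm : ‖pairLower d x y (occ v.ofLp) (pairHole d x y)‖ ^ 2 ≤
      pairEnergy d x y (occ v.ofLp) :=
    ((supportedBelow_occ v.ofLp).pairLower x y).summable_norm_sq.le_tsum _
      fun n _ => by positivity
  have hd' : (0 : ℝ) < d := by exact_mod_cast hd
  rw [pairLower_pairHole hd hxy, norm_sqrt_mul_sq hd'.le] at hterm
  have h3 : ‖v.ofLp (magnon d y) - v.ofLp (magnon d x)‖ ^ 2 ≤ 0 := by
    by_contra! hc
    have := mul_pos hd' hc
    linarith
  have h4 : ‖v.ofLp (magnon d y) - v.ofLp (magnon d x)‖ = 0 := by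
    have := le_antisymm h3 (sq_nonneg _)
    simpa using this
  exact (sub_eq_zero.1 (norm_eq_zero.1 h4)).symm

end Magnon

/-! ### The trial state and the upper bound on the gap -/

section TrialState

/-- Neighbours differ by a vector in {-1, 0, 1}³; this crude count is enough. -/
lemma card_adj_le (x : Box ℓ) : (Finset.univ.filter fun y : Box ℓ => Adj x y).card ≤ 27 := by
  have hcard : (Fintype.piFinset fun _ : Fin 3 => Finset.Icc (-1 : ℤ) 1).card = 27 := by
    simp
  rw [← hcard]
  refine Finset.card_le_card_of_injOn (fun y i => ((x i : ℕ) : ℤ) - ((y i : ℕ) : ℤ)) ?_ ?_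
  · intro y hy
    have hy : Adj x y := (Finset.mem_filter.1 hy).2
    refine Fintype.mem_piFinset.2 fun i => ?_
    have h1 : |((x i : ℕ) : ℤ) - ((y i : ℕ) : ℤ)| ≤ 1 :=
      hy ▸ Finset.single_le_sum (f := fun i => |((x i : ℕ) : ℤ) - ((y i : ℕ) : ℤ)|)
        (fun j _ => abs_nonneg _) (Finset.mem_univ i)
    exact Finset.mem_Icc.2 (abs_le.1 h1)
  · intro y _ y' _ h
    ext i
    have := congrFun h i
    simp only at this
    omega

lemma adj_sub_sq_le {x y : Box ℓ} (h : Adj x y) (i : Fin 3) :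
    (((y i : ℕ) : ℝ) - ((x i : ℕ) : ℝ)) ^ 2 ≤ 1 := by
  have h1 : |((x i : ℕ) : ℤ) - ((y i : ℕ) : ℤ)| ≤ 1 :=
    h ▸ Finset.single_le_sum (f := fun i => |((x i : ℕ) : ℤ) - ((y i : ℕ) : ℤ)|)
      (fun j _ => abs_nonneg _) (Finset.mem_univ i)
  have h2 : |((x i : ℕ) : ℝ) - ((y i : ℕ) : ℝ)| ≤ 1 := by exact_mod_cast h1
  rw [abs_sub_comm] at h2
  rw [← sq_abs]
  exact pow_le_one₀ (abs_nonneg _) h2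

lemma sum_box_eq (hℓ : 0 < ℓ) (i : Fin 3) (g : Fin ℓ → ℝ) :
    ∑ x : Box ℓ, g (x i) = (ℓ : ℝ) ^ 2 * ∑ t, g t := by
  have h := IsSqDist.sum_update i fun x : Box ℓ => g (x i)
  simp only [update_self, Finset.sum_const, Finset.card_univ, Fintype.card_fun, Fintype.card_fin,
    nsmul_eq_mul] at h
  have hL : (ℓ : ℝ) ≠ 0 := by exact_mod_cast hℓ.ne'
  refine mul_left_cancel₀ hL ?_
  rw [← h]
  push_cast
  ring

lemma sum_fin_cast (n : ℕ) : ∑ t : Fin n, ((t : ℕ) : ℝ) = n * (n - 1) / 2 := by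
  rw [← Finset.sum_range (fun t => (t : ℝ))]
  induction n with
  | zero => simp
  | succ n ih => rw [Finset.sum_range_succ, ih]; push_cast; ring

lemma sum_fin_cast_sq (n : ℕ) :
    ∑ t : Fin n, ((t : ℕ) : ℝ) ^ 2 = n * (n - 1) * (2 * n - 1) / 6 := by
  rw [← Finset.sum_range (fun t => (t : ℝ) ^ 2)]
  induction n with
  | zero => simp
  | succ n ih => rw [Finset.sum_range_succ, ih]; push_cast; ring

/-- The first coordinate measured from the centre of the box. -/
noncomputable def centred (x : Box ℓ) : ℝ := ((x 0 : ℕ) : ℝ) - ((ℓ : ℝ) - 1) / 2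

lemma sum_centred (hℓ : 0 < ℓ) : ∑ x : Box ℓ, centred x = 0 := by
  unfold centred
  rw [sum_box_eq hℓ 0 fun t => ((t : ℕ) : ℝ) - ((ℓ : ℝ) - 1) / 2, Finset.sum_sub_distrib,
    sum_fin_cast]
  simp
  ring_nf
  simp

lemma sum_centred_sq (hℓ : 0 < ℓ) :
    ∑ x : Box ℓ, centred x ^ 2 = (ℓ : ℝ) ^ 3 * ((ℓ : ℝ) ^ 2 - 1) / 12 := by
  unfold centred
  rw [sum_box_eq hℓ 0 fun t => (((t : ℕ) : ℝ) - ((ℓ : ℝ) - 1) / 2) ^ 2]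
  simp only [sub_sq, Finset.sum_sub_distrib, Finset.sum_add_distrib, sum_fin_cast_sq,
    ← Finset.sum_mul, ← Finset.mul_sum, sum_fin_cast]
  simp
  ring

lemma inner_hamiltonian_magnonState_centred_le (hd : 0 < d) :
    (inner ℂ (magnonState d (centred (ℓ := ℓ)))
      (hamiltonian d ℓ (magnonState d (centred (ℓ := ℓ))))).re ≤ 27 / 4 * d * (ℓ : ℝ) ^ 3 := by
  rw [inner_hamiltonian_re]
  have h : ∀ x : Box ℓ, (∑ y : Box ℓ, if Adj x y then
      pairEnergy d x y (occ (magnonState d (centred (ℓ := ℓ))).ofLp) else 0) ≤ 27 * d := by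
    intro x
    rw [← Finset.sum_filter]
    refine (Finset.sum_le_card_nsmul _ _ (d : ℝ) fun y hy => ?_).trans ?_
    · have hy : Adj x y := (Finset.mem_filter.1 hy).2
      have h1 := adj_sub_sq_le hy 0
      rw [pairEnergy_magnonState hd _ hy.ne, centred, centred, sub_sub_sub_cancel_right]
      exact mul_le_of_le_one_right (Nat.cast_nonneg d) h1
    · rw [nsmul_eq_mul]
      have : ((Finset.univ.filter fun y : Box ℓ => Adj x y).card : ℝ) ≤ 27 := by
        exact_mod_cast card_adj_le x
      gcongr
  have h2 := Finset.sum_le_sum fun x (_ : x ∈ (Finset.univ : Finset (Box ℓ))) => h x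
  simp only [Finset.sum_const, Finset.card_univ, Fintype.card_fun, Fintype.card_fin,
    nsmul_eq_mul] at h2
  push_cast at h2
  linarith

/-- There is a positive energy of order `S / ℓ ^ 2`. -/
lemma gap_upper_bound (hd : 1 ≤ d) (hℓ : 2 ≤ ℓ) :
    ∃ E ∈ energies d ℓ, 0 < E ∧ E ≤ 216 * spin d / (ℓ : ℝ) ^ 2 := by
  have hℓ0 : 0 < ℓ := by omega
  have hL : (2 : ℝ) ≤ ℓ := by exact_mod_cast hℓ
  have hd' : (0 : ℝ) < d := by exact_mod_cast hd
  have hnorm := norm_sq_magnonState (d := d) (by omega) (centred (ℓ := ℓ))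
  rw [sum_centred_sq hℓ0] at hnorm
  have hpos : 0 < (ℓ : ℝ) ^ 3 * ((ℓ : ℝ) ^ 2 - 1) / 12 := by
    have : (0 : ℝ) < (ℓ : ℝ) ^ 2 - 1 := by nlinarith
    positivity
  refine exists_pos_eigenvalue_le hamiltonian_isSymmetric (fun μ => energies_nonneg)
    (φ := magnonState d (centred (ℓ := ℓ))) ?_ ?_ ?_
  · intro h0
    rw [h0, norm_zero] at hnorm
    norm_num at hnorm
    linarith
  · intro v hv
    have x₀ : Box ℓ := fun _ => ⟨0, hℓ0⟩
    rw [inner_magnonState]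
    simp only [magnon_amplitude_eq hd hv _ x₀]
    rw [← Finset.sum_mul, ← Complex.ofReal_sum, sum_centred hℓ0, Complex.ofReal_zero, zero_mul]
  · refine (inner_hamiltonian_magnonState_centred_le (by omega)).trans ?_
    rw [hnorm, spin]
    have e : 216 * ((d : ℝ) / 2) / (ℓ : ℝ) ^ 2 * ((ℓ : ℝ) ^ 3 * ((ℓ : ℝ) ^ 2 - 1) / 12) =
        9 * d * ℓ * ((ℓ : ℝ) ^ 2 - 1) := by
      field_simp
      ring
    rw [e]
    -- The energy over the squared norm is at most 162 S/(ℓ² - 1), and ℓ² - 1 ≥ 3ℓ²/4 for ℓ ≥ 2;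
    -- hence the constant 216.
    have h1 : 0 ≤ (d : ℝ) * ℓ * ((ℓ : ℝ) ^ 2 - 4) := by
      have : (0 : ℝ) ≤ (ℓ : ℝ) ^ 2 - 4 := by nlinarith
      positivity
    nlinarith

end TrialState

lemma finite_energies : (energies d ℓ).Finite :=
  (Module.End.finite_hasEigenvalue (hamiltonian d ℓ)).preimage Complex.ofReal_injective.injOn

end Heisenberg

/-- Excitation spectrum bound for the Heisenberg ferromagnet of spin `S = d / 2 ≥ 1 / 2` on a
box with `ℓ` sites per side and free boundary conditions. The constants depend on nothing. -/
theorem proposition1 :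
    ∃ C C' : ℝ, 0 < C ∧ ∀ d ℓ : ℕ, 1 ≤ d → 1 ≤ ℓ →
      -- `H_ℓ` is a symmetric operator that leaves each sector of fixed total spin invariant, and
      -- its restriction to the sector is bounded below in the sense of operators
      (Heisenberg.hamiltonian d ℓ).IsSymmetric ∧
      (∀ s : ℝ, 0 ≤ s →
        (∀ ψ ∈ Heisenberg.sector d ℓ s,
          Heisenberg.hamiltonian d ℓ ψ ∈ Heisenberg.sector d ℓ s) ∧
        (∀ ψ ∈ Heisenberg.sector d ℓ s,
          C * Heisenberg.spin d / (ℓ : ℝ) ^ 2 *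
              (Heisenberg.spin d * (ℓ : ℝ) ^ 3 - s) * ‖ψ‖ ^ 2 ≤
            (inner ℂ ψ (Heisenberg.hamiltonian d ℓ ψ)).re)) ∧
      -- the ground state energy is zero
      IsLeast (Heisenberg.energies d ℓ) 0 ∧
      -- the energy gap above it is of order `S / ℓ ^ 2`
      (2 ≤ ℓ → ∃ g : ℝ, IsLeast {E : ℝ | E ∈ Heisenberg.energies d ℓ ∧ 0 < E} g ∧
        C * Heisenberg.spin d / (ℓ : ℝ) ^ 2 ≤ g ∧
        g ≤ C' * Heisenberg.spin d / (ℓ : ℝ) ^ 2) := by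
  refine ⟨1 / 18, 216, by norm_num, fun d ℓ hd hℓ => ⟨Heisenberg.hamiltonian_isSymmetric,
    fun s hs => ⟨fun ψ hψ => Heisenberg.hamiltonian_mem_sector hψ,
      fun ψ hψ => Heisenberg.sector_bound hd hℓ hs hψ⟩,
    ⟨Heisenberg.zero_mem_energies, fun E hE => Heisenberg.energies_nonneg hE⟩, fun hℓ2 => ?_⟩⟩
  obtain ⟨E, hE, hE0, hEle⟩ := Heisenberg.gap_upper_bound hd hℓ2
  have hfin : {E : ℝ | E ∈ Heisenberg.energies d ℓ ∧ 0 < E}.Finite :=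
    Heisenberg.finite_energies.subset fun _ h => h.1
  obtain ⟨g, hg, hmin⟩ := Set.exists_min_image _ id hfin ⟨E, hE, hE0⟩
  exact ⟨g, ⟨hg, hmin⟩, Heisenberg.gap_lower_bound hd hℓ hg.1 hg.2, (hmin E ⟨hE, hE0⟩).trans hEle⟩
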